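/- Let $F$ be a finite field of characteristic $2$ with $q$ elements and let $V$ be a vector space over $F$ of finite dimension $n\ge 1$. For a quadratic form $Q$ on $V$ with polar form $f_Q(u,v)=Q(u+v)-Q(u)-Q(v)$, call $Q$ nonsingular if the only $v\in V$ with $Q(v)=0$ and $f_Q(u,v)=0$ for all $u\in V$ is $v=0$, and let $O(V,Q)$ be the group of linear maps $g:V\to V$ with $Q(g(v))=Q(v)$ for all $v\in V$. The orthogonal groups of $V$ are the groups $O(V,Q)$ with $Q$ nonsingular. (1) If $n=2m+1$ is odd, there is up to isomorphism exactly one orthogonal group $O(n)$: nonsingular quadratic forms on $V$ exist, the groups $O(V,Q)$ for any two of them are isomorphic, and $O(V,Q)\cong \mathrm{Sp}(n-1)$, the symplectic group of $2m\times 2m$ matrices over $F$. (2) If $n=2m$ is even, there are up to isomorphism exactly two orthogonal groups $O^{+}(n)$ and $O^{-}(n)$, and they are distinguished by their orders. Precisely, say that $Q$ is of plus type if there is a subspace of $V$ of dimension $m$ on which $Q$ vanishes; write $O^+(n)$ for $O(V,Q)$ if $Q$ is nonsingular of plus type and $O^-(n)$ if $Q$ is nonsingular and not of plus type. Nonsingular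 forms of both kinds exist on $V$. For nonsingular $Q,Q'$, the groups $O(V,Q)$ and $O(V,Q')$ are isomorphic if and only if $Q$ and $Q'$ are both of plus type or both not of plus type, and also if and only if they have the same order. The orders are $$|O^{\pm}(n)| = 2\,(q^m\mp 1)\,q^{m(m-1)}\prod_{i=1}^{m-1}\bigl(q^{2m-2i}-1\bigr).$$ -/

import Mathlib

namespace OrthogonalChar2

variable {F V : Type*} [Field F] [AddCommGroup V] [Module F V]

/-- A quadratic form `Q` is nonsingular if its radical, the space of all `v` with `Q v = 0` and
`f_Q (u, v) = 0` for all `u`, is zero. Here `f_Q` is the polar form of `Q`; it may be degenerate. -/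
def IsNonsingular (Q : QuadraticForm F V) : Prop :=
  Q.radical = ⊥

/-- The orthogonal group `O(V, Q)`: the linear automorphisms `g` of `V` with `Q (g v) = Q v`
for all `v`. -/
def orthogonalGroup (Q : QuadraticForm F V) : Subgroup (V ≃ₗ[F] V) where
  carrier := {g | ∀ v, Q (g v) = Q v}
  mul_mem' := fun {g h} hg hh v => by
    rw [LinearEquiv.mul_apply, hg, hh]
  one_mem' := fun _ => rfl
  inv_mem' := fun {g} hg v => by
    have h := hg (g⁻¹ v)
    rw [← h, ← LinearEquiv.mul_apply, mul_inv_cancel]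
    rfl

/-- For nonsingular `Q` in finite dimension every linear map preserving `Q` is an automorphism, so
asking for invertibility in `orthogonalGroup` excludes nothing. -/
theorem exists_mem_orthogonalGroup [FiniteDimensional F V] {Q : QuadraticForm F V}
    (hQ : IsNonsingular Q) (g : V →ₗ[F] V) (hg : ∀ v, Q (g v) = Q v) :
    ∃ e ∈ orthogonalGroup Q, (e : V →ₗ[F] V) = g := by
  have hinj : Function.Injective g := by
    rw [← LinearMap.ker_eq_bot, eq_bot_iff]
    intro v hv
    rw [LinearMap.mem_ker] at hv
    rw [← show Q.radical = ⊥ from hQ, QuadraticMap.mem_radical_iff']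
    refine ⟨by rw [← hg, hv, QuadraticMap.map_zero], fun w => ?_⟩
    rw [← hg (v + w), map_add, hv, zero_add, hg]
  exact ⟨LinearEquiv.ofInjectiveEndo g hinj, fun v => hg v, rfl⟩

/-- A subspace is totally isotropic for `Q` if all its nonzero vectors are isotropic, that is,
if `Q` vanishes on it. -/
def IsTotallyIsotropic (Q : QuadraticForm F V) (W : Submodule F V) : Prop :=
  ∀ w ∈ W, Q w = 0

/-- In dimension `2 m`, the form `Q` is of plus type if it has a totally isotropic subspace of
dimension `m`. For a nonsingular form `Q` of plus type `O(V, Q)` is written `O⁺(2 m)`, and for one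
that is not of plus type it is written `O⁻(2 m)`. -/
def IsPlusType (Q : QuadraticForm F V) : Prop :=
  ∃ W : Submodule F V, IsTotallyIsotropic Q W ∧ 2 * Module.finrank F W = Module.finrank F V

end OrthogonalChar2

/-! In characteristic two the polar form is alternating. On its radical R the form `Q` is additive
with Q(cv) = c²Q(v), and nonsingularity says that `Q` has no nonzero zero on R. Every element of a
finite field of characteristic two is a square, so two vectors of R are always proportional and dim
R ≤ 1. A nondegenerate alternating form lives in even dimension, so R is a line for odd n and zero
for even n.

Odd n: squaring is injective, so an isometry fixes R pointwise, and it induces a symplectic map of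
V/R. Conversely a symplectic map f lifts uniquely: the defect Q(w) + Q(f w) is additive because f
preserves the polar form, so up to a scalar it is the square of a linear functional, and this
functional is the R-component of the lift (`exists_inducedEnd_eq`, `eq_of_inducedEnd_eq`).

Even n: hyperbolic planes are peeled off until the space is zero or an anisotropic plane. The number
of singular vectors is determined by dimension and type and determines the type
(`natCard_singular`); hence adding or removing a hyperbolic plane preserves the type, which takes
the place of Witt cancellation. The isometries between two forms of the same type are then counted
by induction (`natCard_isometryEquiv`): hyperbolic pairs in the target times isometries between the
complements. The base case is the plane x² + xy + ay² with a outside the image of x ↦ x² + x, a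
subgroup of index two. The count is positive, so forms of the same type are isometric; for equal
forms it is the group order. The orders of the two types differ in the factor q^m ∓ 1, so the order
recovers the type. -/

namespace OrthogonalChar2

open QuadraticMap

/-! ### Splitting a hyperbolic plane off an alternating form -/

section Splitting

variable {F V : Type*} [Field F] [AddCommGroup V] [Module F V]

/-- The common orthogonal complement of `u` and `v` with respect to a bilinear form. -/
def pairPerp (B : LinearMap.BilinForm F V) (u v : V) : Submodule F V :=
  LinearMap.ker (B u) ⊓ LinearMap.ker (B v)

theorem mem_pairPerp {B : LinearMap.BilinForm F V} {u v w : V} :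
    w ∈ pairPerp B u v ↔ B u w = 0 ∧ B v w = 0 := by
  simp [pairPerp]

/-- An alternating form splits off a hyperbolic plane. -/
def pairSplit (B : LinearMap.BilinForm F V) (hB : B.IsAlt) (u v : V) (huv : B u v = 1) :
    (F × F × pairPerp B u v) ≃ₗ[F] V where
  toFun x := x.1 • u + x.2.1 • v + x.2.2
  map_add' x y := by
    simp only [Prod.fst_add, Prod.snd_add, add_smul, Submodule.coe_add]; abel
  map_smul' c x := by
    simp only [Prod.smul_fst, Prod.smul_snd, smul_eq_mul, mul_smul, Submodule.coe_smul, smul_add,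
      RingHom.id_apply]
  invFun x := (-B v x, B u x, ⟨x + B v x • u - B u x • v, by
    have hvu : B v u = -1 := by rw [← huv, LinearMap.IsAlt.neg hB]
    rw [mem_pairPerp]
    simp [huv, hvu, hB.self_eq_zero]⟩)
  left_inv x := by
    obtain ⟨a, b, w, hw⟩ := x
    have hvu : B v u = -1 := by rw [← huv, LinearMap.IsAlt.neg hB]
    rw [mem_pairPerp] at hw
    simp only [map_add, map_smul, smul_eq_mul, hB.self_eq_zero, huv, hvu, hw.1, hw.2]
    ext <;> simp
    abel
  right_inv x := by
    simp only [neg_smul]; abel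

theorem pairSplit_apply (B : LinearMap.BilinForm F V) (hB : B.IsAlt) (u v : V) (huv : B u v = 1)
    (x : F × F × pairPerp B u v) :
    pairSplit B hB u v huv x = x.1 • u + x.2.1 • v + x.2.2 := rfl

theorem finrank_pairPerp [FiniteDimensional F V] (B : LinearMap.BilinForm F V) (hB : B.IsAlt)
    (u v : V) (huv : B u v = 1) :
    Module.finrank F V = Module.finrank F (pairPerp B u v) + 2 := by
  rw [← (pairSplit B hB u v huv).finrank_eq]
  simp only [Module.finrank_prod, Module.finrank_self]
  ring

theorem bilin_pairSplit (B : LinearMap.BilinForm F V) (hB : B.IsAlt) (u v : V) (huv : B u v = 1)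
    (x y : F × F × pairPerp B u v) :
    B (pairSplit B hB u v huv x) (pairSplit B hB u v huv y) =
      x.1 * y.2.1 - x.2.1 * y.1 + B x.2.2 y.2.2 := by
  obtain ⟨a, b, w, hw⟩ := x
  obtain ⟨a', b', w', hw'⟩ := y
  have hvu : B v u = -1 := by rw [← huv, LinearMap.IsAlt.neg hB]
  rw [mem_pairPerp] at hw hw'
  have h1 : B w u = 0 := (hB.eq_iff).1 hw.1
  have h2 : B w v = 0 := (hB.eq_iff).1 hw.2
  simp only [pairSplit_apply, map_add, map_smul, LinearMap.add_apply, LinearMap.smul_apply,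
    smul_eq_mul, hB.self_eq_zero, huv, hvu, hw'.1, hw'.2, h1, h2]
  ring

theorem separatingLeft_pairPerp {B : LinearMap.BilinForm F V} (hB : B.IsAlt)
    (hnd : B.SeparatingLeft) {u v : V} (huv : B u v = 1) :
    (B.restrict (pairPerp B u v)).SeparatingLeft := by
  intro w hw
  have key : (w : V) = 0 := by
    refine hnd _ fun y => ?_
    obtain ⟨y, rfl⟩ := (pairSplit B hB u v huv).surjective y
    have := bilin_pairSplit B hB u v huv (0, 0, w) y
    have h3 : B w y.2.2 = 0 := hw y.2.2
    simp only [pairSplit_apply, zero_smul, zero_add, zero_mul, sub_zero, h3] at this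
    exact this
  exact_mod_cast key

theorem exists_bilin_eq_one {B : LinearMap.BilinForm F V} (hnd : B.SeparatingLeft) {u : V}
    (hu : u ≠ 0) : ∃ v, B u v = 1 := by
  have : ¬ ∀ y, B u y = 0 := fun h => hu (hnd u h)
  push Not at this
  obtain ⟨y, hy⟩ := this
  exact ⟨(B u y)⁻¹ • y, by simp [hy]⟩

end Splitting

/-! ### Symplectic bases -/

section SymplecticBasis

theorem exists_symplectic_basis_aux {F : Type*} [Field F] (k : ℕ) :
    ∀ {V : Type*} [AddCommGroup V] [Module F V] [FiniteDimensional F V]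
    (B : LinearMap.BilinForm F V), B.IsAlt → B.SeparatingLeft → Module.finrank F V = k →
    ∃ (ι : Type) (_ : Fintype ι) (_ : DecidableEq ι) (b : Module.Basis (ι ⊕ ι) F V),
      ∀ i j, B (b i) (b j) = Matrix.J ι F i j := by
  induction k using Nat.strong_induction_on with
  | _ k ih =>
  intro V _ _ _ B hB hnd hk
  rcases subsingleton_or_nontrivial V with h | h
  · exact ⟨Empty, inferInstance, inferInstance, Module.Basis.empty V, fun i => i.elim nofun nofun⟩
  obtain ⟨v, hv⟩ := exists_ne (0 : V)
  obtain ⟨u', hu'⟩ := exists_bilin_eq_one hnd hv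
  obtain ⟨u, hu⟩ : ∃ u, B u v = 1 := ⟨-u', by rw [map_neg, LinearMap.neg_apply, LinearMap.IsAlt.neg hB, hu']⟩
  obtain ⟨ι, _, _, b, hb⟩ := ih (Module.finrank F (pairPerp B u v))
    (by have := finrank_pairPerp B hB u v hu; omega) (B.restrict (pairPerp B u v))
    (fun x => hB x) (separatingLeft_pairPerp hB hnd hu) rfl
  let s : Module.Basis Unit F F := Module.Basis.singleton Unit F
  -- `Matrix.J` has -1 in its upper right block, so `v` goes to the left summand and `u` to the
  -- right one; this is the reason for the swap `Equiv.sumComm`.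
  let b' : Module.Basis ((Unit ⊕ ι) ⊕ (Unit ⊕ ι)) F V :=
    ((s.prod (s.prod b)).map (pairSplit B hB u v hu)).reindex
      ((Equiv.sumAssoc Unit Unit (ι ⊕ ι)).symm.trans
        ((Equiv.sumCongr (Equiv.sumComm _ _) (Equiv.refl _)).trans
          (Equiv.sumSumSumComm Unit Unit ι ι)))
  have hb1 : b' (Sum.inl (Sum.inl ())) = pairSplit B hB u v hu (0, 1, 0) := by
    simp [b', s]
  have hb2 : b' (Sum.inr (Sum.inl ())) = pairSplit B hB u v hu (1, 0, 0) := by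
    simp [b', s]
    rfl
  have hb3 : ∀ i, b' (Sum.inl (Sum.inr i)) = pairSplit B hB u v hu (0, 0, b (Sum.inl i)) := by
    intro i; simp [b']
  have hb4 : ∀ i, b' (Sum.inr (Sum.inr i)) = pairSplit B hB u v hu (0, 0, b (Sum.inr i)) := by
    intro i; simp [b']
  have hb' : ∀ i j, B (b i) (b j) = Matrix.J ι F i j := hb
  refine ⟨Unit ⊕ ι, inferInstance, inferInstance, b', ?_⟩
  rintro ((⟨⟩ | i) | (⟨⟩ | i)) ((⟨⟩ | j) | (⟨⟩ | j)) <;>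
  simp only [hb1, hb2, hb3, hb4, bilin_pairSplit, hb'] <;>
  simp [Matrix.J, Matrix.one_apply]

theorem exists_symplectic_basis {F V : Type*} [Field F] [AddCommGroup V] [Module F V]
    [FiniteDimensional F V] (B : LinearMap.BilinForm F V) (hB : B.IsAlt)
    (hnd : B.SeparatingLeft) :
    ∃ (m : ℕ) (b : Module.Basis (Fin m ⊕ Fin m) F V),
      ∀ i j, B (b i) (b j) = Matrix.J (Fin m) F i j := by
  obtain ⟨ι, _, _, b, hb⟩ := exists_symplectic_basis_aux _ B hB hnd rfl
  let e := Fintype.equivFin ι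
  refine ⟨Fintype.card ι, b.reindex (Equiv.sumCongr e e), ?_⟩
  rintro (i | i) (j | j) <;> simp [hb, Matrix.J, Matrix.one_apply]

end SymplecticBasis

/-! ### The polar form and its radical -/

section Polar

variable {F V : Type*} [Field F] [AddCommGroup V] [Module F V]

theorem apply_add (Q : QuadraticForm F V) (x y : V) : Q (x + y) = Q x + Q y + polar Q x y := by
  simp [polar]

theorem isNonsingular_iff {Q : QuadraticForm F V} :
    IsNonsingular Q ↔ ∀ v, Q v = 0 → (∀ w, polar Q v w = 0) → v = 0 := by
  rw [IsNonsingular, eq_bot_iff]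
  refine forall_congr' fun v => ?_
  rw [mem_radical_iff', Submodule.mem_bot, and_imp]
  refine imp_congr_right fun h => imp_congr_left (forall_congr' fun w => ?_)
  simp [polar, h, sub_eq_zero]

theorem isAlt_polarBilin [CharP F 2] (Q : QuadraticForm F V) : Q.polarBilin.IsAlt := fun x => by
  simp [CharTwo.two_eq_zero]

/-- Conjugation by an isometry identifies the orthogonal groups. -/
def orthogonalGroupCongr {W : Type*} [AddCommGroup W] [Module F W] {Q : QuadraticForm F V}
    {Q' : QuadraticForm F W} (e : Q.IsometryEquiv Q') :
    orthogonalGroup Q ≃* orthogonalGroup Q' where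
  toFun g := ⟨(e.toLinearEquiv.symm.trans g.1).trans e.toLinearEquiv, fun v => by
    have h := g.2 (e.symm v)
    exact (e.map_app _).trans (h.trans (e.symm.map_app v))⟩
  invFun g := ⟨(e.toLinearEquiv.trans g.1).trans e.toLinearEquiv.symm, fun v => by
    have h := g.2 (e v)
    exact (e.symm.map_app _).trans (h.trans (e.map_app v))⟩
  left_inv g := by ext v; simp
  right_inv g := by ext v; simp
  map_mul' g h := by ext v; simp

theorem polar_map_orthogonalGroup {Q : QuadraticForm F V} {g : V ≃ₗ[F] V}
    (hg : g ∈ orthogonalGroup Q) (x y : V) : polar Q (g x) (g y) = polar Q x y := by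
  simp only [polar, ← map_add, show ∀ v, Q (g v) = Q v from hg]

/-- The polar form is nondegenerate on a complement of its radical. -/
theorem separatingLeft_restrict_of_isCompl {Q : QuadraticForm F V} {W : Submodule F V}
    (h : IsCompl (LinearMap.ker Q.polarBilin) W) :
    (Q.comp W.subtype).polarBilin.SeparatingLeft := by
  intro w hw
  have hw' : ∀ w' : W, polar Q (w : V) w' = 0 := hw
  have : (w : V) ∈ LinearMap.ker Q.polarBilin := by
    rw [LinearMap.mem_ker]
    ext x
    obtain ⟨r, hr, w', hw'', rfl⟩ := Submodule.mem_sup.1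
      (show x ∈ LinearMap.ker Q.polarBilin ⊔ W from h.sup_eq_top ▸ Submodule.mem_top)
    have h1 : polar Q (w : V) r = 0 := by
      rw [polar_comm]; exact LinearMap.congr_fun (LinearMap.mem_ker.1 hr) _
    rw [polarBilin_apply_apply, polar_add_right, h1, hw' ⟨w', hw''⟩]
    simp
  exact Subtype.ext (by simpa using h.disjoint.le_bot ⟨this, w.2⟩)

variable [CharP F 2]

theorem finrank_ker_polarBilin_le_one [Fintype F] {Q : QuadraticForm F V}
    (hQ : IsNonsingular Q) : Module.finrank F (LinearMap.ker Q.polarBilin) ≤ 1 := by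
  by_cases h : ∃ r : LinearMap.ker Q.polarBilin, r ≠ 0
  · obtain ⟨⟨r, hr⟩, hr0⟩ := h
    rw [isNonsingular_iff] at hQ
    have hpol : ∀ {s}, s ∈ LinearMap.ker Q.polarBilin → ∀ w, polar Q s w = 0 := fun hs w =>
      LinearMap.congr_fun (LinearMap.mem_ker.1 hs) w
    have hQr : Q r ≠ 0 := fun h0 => hr0 (Subtype.ext (hQ r h0 (hpol hr)))
    refine finrank_le_one ⟨r, hr⟩ fun ⟨s, hs⟩ => ?_
    -- With c² Q(r) = Q(s), the vector `c • r - s` is singular and lies in the radical of the polar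
    -- form, hence is zero.
    obtain ⟨c, hc⟩ := (frobeniusEquiv F 2).surjective (Q s / Q r)
    rw [frobeniusEquiv_def, eq_div_iff hQr] at hc
    refine ⟨c, Subtype.ext ?_⟩
    have hmem : c • r - s ∈ LinearMap.ker Q.polarBilin :=
      Submodule.sub_mem _ (Submodule.smul_mem _ _ hr) hs
    refine sub_eq_zero.1 (hQ (c • r - s) ?_ (hpol hmem))
    have hp : polar Q (c • r) (-s) = 0 := hpol (Submodule.smul_mem _ _ hr) _
    rw [sub_eq_add_neg, apply_add, hp, QuadraticMap.map_neg, QuadraticMap.map_smul, smul_eq_mul,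
      ← hc, ← pow_two, add_zero, CharTwo.add_self_eq_zero]
  · push Not at h
    have : Subsingleton (LinearMap.ker Q.polarBilin) := ⟨fun a b => (h a).trans (h b).symm⟩
    rw [Module.finrank_zero_of_subsingleton]
    exact zero_le_one

theorem exists_symplectic_basis_compl [FiniteDimensional F V] (Q : QuadraticForm F V) :
    ∃ (W : Submodule F V) (m : ℕ) (b : Module.Basis (Fin m ⊕ Fin m) F W),
      IsCompl (LinearMap.ker Q.polarBilin) W ∧
      (∀ i j, (Q.comp W.subtype).polarBilin (b i) (b j) = Matrix.J (Fin m) F i j) ∧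
      Module.finrank F V = Module.finrank F (LinearMap.ker Q.polarBilin) + 2 * m := by
  obtain ⟨W, hW⟩ := Submodule.exists_isCompl (LinearMap.ker Q.polarBilin)
  obtain ⟨m, b, hb⟩ := exists_symplectic_basis _ (isAlt_polarBilin (Q.comp W.subtype))
    (separatingLeft_restrict_of_isCompl hW)
  refine ⟨W, m, b, hW, hb, ?_⟩
  rw [← Submodule.finrank_add_eq_of_isCompl hW, Module.finrank_eq_card_basis b]
  simp; ring

/-- A complement of the polar radical has even dimension, so the radical has even dimension at most
one. -/
theorem separatingLeft_of_even [Fintype F] [FiniteDimensional F V] {Q : QuadraticForm F V}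
    (hQ : IsNonsingular Q) {m : ℕ} (hV : Module.finrank F V = 2 * m) :
    Q.polarBilin.SeparatingLeft := by
  obtain ⟨W, k, b, -, -, h⟩ := exists_symplectic_basis_compl Q
  have h1 := finrank_ker_polarBilin_le_one hQ
  rw [LinearMap.separatingLeft_iff_ker_eq_bot, ← Submodule.finrank_eq_zero]
  omega

end Polar

/-! ### Odd dimension: the isomorphism with the symplectic group -/

section Odd

variable {F W : Type*} [Field F] [AddCommGroup W] [Module F W]
  {Q : QuadraticForm F (W × F)} {Q₁ : QuadraticForm F W} {a : F} {m : ℕ}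

/-- The action of an isometry on the quotient by the radical of the polar form. -/
def inducedEnd (g : (W × F) ≃ₗ[F] (W × F)) : W →ₗ[F] W :=
  LinearMap.fst F W F ∘ₗ g.toLinearMap ∘ₗ LinearMap.inl F W F

theorem inducedEnd_apply (g : (W × F) ≃ₗ[F] (W × F)) (w : W) : inducedEnd g w = (g (w, 0)).1 := rfl

theorem mem_symplecticGroup_iff_polar {b : Module.Basis (Fin m ⊕ Fin m) F W}
    (hb : ∀ i j, Q₁.polarBilin (b i) (b j) = Matrix.J (Fin m) F i j) (f : W →ₗ[F] W) :
    LinearMap.toMatrix b b f ∈ Matrix.symplecticGroup (Fin m) F ↔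
      ∀ x y, polar Q₁ (f x) (f y) = polar Q₁ x y := by
  have hJ : LinearMap.BilinForm.toMatrix b Q₁.polarBilin = Matrix.J (Fin m) F := by
    ext i j; rw [LinearMap.BilinForm.toMatrix_apply, hb]
  rw [SymplecticGroup.mem_iff', ← hJ, ← LinearMap.BilinForm.toMatrix_comp b b,
    EmbeddingLike.apply_eq_iff_eq, LinearMap.ext_iff₂]
  rfl

variable [CharP F 2]

theorem polar_prod_line (hQ : ∀ w c, Q (w, c) = Q₁ w + c ^ 2 * a) (x y : W × F) :
    polar Q x y = polar Q₁ x.1 y.1 := by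
  obtain ⟨w, c⟩ := x
  obtain ⟨w', c'⟩ := y
  simp only [polar, Prod.mk_add_mk, hQ, CharTwo.add_sq]
  ring

/-- The line is the radical of the polar form, so it is preserved; on it `Q` is c ↦ c²a, which is
injective, so every point is fixed. -/
theorem orthogonalGroup_fixes_line (hQ : ∀ w c, Q (w, c) = Q₁ w + c ^ 2 * a) (ha : a ≠ 0)
    (hnd : Q₁.polarBilin.SeparatingLeft) {g : (W × F) ≃ₗ[F] (W × F)}
    (hg : g ∈ orthogonalGroup Q) (c : F) : g (0, c) = (0, c) := by
  have h1 : (g (0, c)).1 = 0 := by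
    refine hnd _ fun w => ?_
    have := polar_map_orthogonalGroup hg (0, c) (g.symm (w, 0))
    rw [g.apply_symm_apply, polar_prod_line hQ, polar_prod_line hQ] at this
    rw [polarBilin_apply_apply, this]
    simp
  have h2 := hg (0, c)
  rw [← Prod.mk.eta (p := g (0, c)), h1, hQ, hQ, add_right_inj, mul_left_inj' ha] at h2
  exact Prod.ext h1 (CharTwo.sq_injective h2)

theorem polar_inducedEnd (hQ : ∀ w c, Q (w, c) = Q₁ w + c ^ 2 * a)
    {g : (W × F) ≃ₗ[F] (W × F)} (hg : g ∈ orthogonalGroup Q) (x y : W) :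
    polar Q₁ (inducedEnd g x) (inducedEnd g y) = polar Q₁ x y := by
  have := polar_map_orthogonalGroup hg (x, 0) (y, 0)
  rwa [polar_prod_line hQ, polar_prod_line hQ] at this

theorem inducedEnd_mul (hQ : ∀ w c, Q (w, c) = Q₁ w + c ^ 2 * a) (ha : a ≠ 0)
    (hnd : Q₁.polarBilin.SeparatingLeft) {g : (W × F) ≃ₗ[F] (W × F)}
    (hg : g ∈ orthogonalGroup Q) (h : (W × F) ≃ₗ[F] (W × F)) :
    inducedEnd (g * h) = inducedEnd g ∘ₗ inducedEnd h := by
  ext w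
  rw [LinearMap.comp_apply, inducedEnd_apply, inducedEnd_apply, inducedEnd_apply,
    LinearEquiv.mul_apply]
  have : h (w, 0) = ((h (w, 0)).1, 0) + (0, (h (w, 0)).2) := by simp
  rw [this, map_add, orthogonalGroup_fixes_line hQ ha hnd hg]
  simp

/-- A symplectic map of the complement lifts to the orthogonal group. -/
theorem exists_inducedEnd_eq [Fintype F] [FiniteDimensional F W]
    (hQ : ∀ w c, Q (w, c) = Q₁ w + c ^ 2 * a) (ha : a ≠ 0) (hns : IsNonsingular Q)
    (f : W →ₗ[F] W) (hf : ∀ x y, polar Q₁ (f x) (f y) = polar Q₁ x y) :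
    ∃ g ∈ orthogonalGroup Q, inducedEnd g = f := by
  let s := (frobeniusEquiv F 2).symm
  have hs : ∀ x, s x ^ 2 = x := fun x => by
    rw [← frobeniusEquiv_def, RingEquiv.apply_symm_apply]
  -- The lift must have the form (w, c) ↦ (f w, l w + c), and preserving `Q` forces l(w)² a = Q₁(w)
  -- + Q₁(f w). The polar terms cancel by `hf`, so the square root is additive.
  let l : W →ₗ[F] F :=
    { toFun := fun w => s ((Q₁ w + Q₁ (f w)) / a)
      map_add' := fun x y => by
        rw [← map_add s, map_add f, apply_add, apply_add, hf, ← add_div]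
        congr 2
        linear_combination (polar Q₁ x y) * (CharTwo.two_eq_zero (R := F))
      map_smul' := fun c x => by
        have hc : s (c * c) = c := by
          rw [← pow_two]; exact (frobeniusEquiv F 2).symm_apply_apply c
        simp only [map_smul, QuadraticMap.map_smul, smul_eq_mul, RingHom.id_apply]
        rw [← mul_add, mul_div_assoc, map_mul, hc] }
  have hl : ∀ w, l w ^ 2 * a = Q₁ w + Q₁ (f w) := fun w => by
    change s _ ^ 2 * a = _
    rw [hs, div_mul_cancel₀ _ ha]
  let G : (W × F) →ₗ[F] (W × F) :=
    (f ∘ₗ LinearMap.fst F W F).prod (l ∘ₗ LinearMap.fst F W F + LinearMap.snd F W F)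
  have hG : ∀ v, Q (G v) = Q v := by
    rintro ⟨w, c⟩
    change Q (f w, l w + c) = _
    rw [hQ, hQ, CharTwo.add_sq, add_mul, hl]
    linear_combination (Q₁ (f w)) * (CharTwo.two_eq_zero (R := F))
  obtain ⟨g, hg, hgG⟩ := exists_mem_orthogonalGroup hns G hG
  refine ⟨g, hg, ?_⟩
  ext w
  rw [inducedEnd_apply]
  exact congrArg Prod.fst (LinearMap.congr_fun hgG (w, 0))

/-- Once the first component of an image is known, the value of `Q` gives the square of the second
one, and squaring is injective. -/
theorem eq_of_inducedEnd_eq (hQ : ∀ w c, Q (w, c) = Q₁ w + c ^ 2 * a) (ha : a ≠ 0)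
    (hnd : Q₁.polarBilin.SeparatingLeft) {g h : (W × F) ≃ₗ[F] (W × F)}
    (hg : g ∈ orthogonalGroup Q) (hh : h ∈ orthogonalGroup Q)
    (hgh : inducedEnd g = inducedEnd h) : g = h := by
  have key : ∀ w, g (w, 0) = h (w, 0) := fun w => by
    have h1 : (g (w, 0)).1 = (h (w, 0)).1 := LinearMap.congr_fun hgh w
    have h2 : Q (g (w, 0)) = Q (h (w, 0)) := (hg _).trans (hh _).symm
    rw [← Prod.mk.eta (p := g (w, 0)), ← Prod.mk.eta (p := h (w, 0)), hQ, hQ, h1, add_right_inj,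
      mul_left_inj' ha] at h2
    exact Prod.ext h1 (CharTwo.sq_injective h2)
  ext1 ⟨w, c⟩
  have : ((w, c) : W × F) = (w, 0) + (0, c) := by simp
  rw [this, map_add, map_add, key, orthogonalGroup_fixes_line hQ ha hnd hg,
    orthogonalGroup_fixes_line hQ ha hnd hh]

theorem nonempty_orthogonalGroup_prod_line_mulEquiv [Fintype F] [FiniteDimensional F W]
    (hQ : ∀ w c, Q (w, c) = Q₁ w + c ^ 2 * a) (ha : a ≠ 0)
    (hnd : Q₁.polarBilin.SeparatingLeft) (hns : IsNonsingular Q)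
    {b : Module.Basis (Fin m ⊕ Fin m) F W}
    (hb : ∀ i j, Q₁.polarBilin (b i) (b j) = Matrix.J (Fin m) F i j) :
    Nonempty (orthogonalGroup Q ≃* Matrix.symplecticGroup (Fin m) F) := by
  let φ : orthogonalGroup Q →* Matrix.symplecticGroup (Fin m) F := MonoidHom.mk'
    (fun g => ⟨LinearMap.toMatrix b b (inducedEnd g.1),
      (mem_symplecticGroup_iff_polar hb _).2 (polar_inducedEnd hQ g.2)⟩)
    (fun g h => Subtype.ext (by
      change LinearMap.toMatrix b b (inducedEnd (g.1 * h.1)) = _ * _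
      rw [inducedEnd_mul hQ ha hnd g.2, LinearMap.toMatrix_comp b b b]))
  refine ⟨MulEquiv.ofBijective φ ⟨fun g h hgh => ?_, fun A => ?_⟩⟩
  · exact Subtype.ext (eq_of_inducedEnd_eq hQ ha hnd g.2 h.2
      ((LinearMap.toMatrix b b).injective (congrArg Subtype.val hgh)))
  · obtain ⟨f, hf⟩ := (LinearMap.toMatrix b b).surjective A.1
    obtain ⟨g, hg, hgf⟩ := exists_inducedEnd_eq hQ ha hns f
      ((mem_symplecticGroup_iff_polar hb f).1 (hf ▸ A.2))
    exact ⟨⟨g, hg⟩, Subtype.ext ((congrArg _ hgf).trans hf)⟩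

end Odd

theorem isNonsingular_of_isometryEquiv {F V W : Type*} [Field F] [AddCommGroup V] [Module F V]
    [AddCommGroup W] [Module F W] {Q : QuadraticForm F V} {Q' : QuadraticForm F W}
    (e : Q.IsometryEquiv Q') (hQ : IsNonsingular Q) : IsNonsingular Q' := by
  rw [IsNonsingular] at *
  rw [← e.map_radical, hQ, Submodule.map_bot]

/-- Parity forces the radical to be exactly a line, spanned by some `r` with `Q r ≠ 0`; this puts
`Q` in the form `Q₁ w + c ^ 2 * a` with `a = Q r`. -/
theorem nonempty_orthogonalGroup_odd_mulEquiv {F V : Type*} [Field F] [Fintype F] [CharP F 2]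
    [AddCommGroup V] [Module F V] [FiniteDimensional F V] {m : ℕ}
    (hV : Module.finrank F V = 2 * m + 1) {Q : QuadraticForm F V} (hQ : IsNonsingular Q) :
    Nonempty (orthogonalGroup Q ≃* Matrix.symplecticGroup (Fin m) F) := by
  obtain ⟨W, k, b, hW, hb, h⟩ := exists_symplectic_basis_compl Q
  have h1 := finrank_ker_polarBilin_le_one hQ
  obtain rfl : k = m := by omega
  obtain ⟨⟨r, hr⟩, hr0, -⟩ := finrank_eq_one_iff'.1
    (show Module.finrank F (LinearMap.ker Q.polarBilin) = 1 by omega)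
  let E : (W × F) ≃ₗ[F] V :=
    ((LinearEquiv.refl F W).prodCongr ((LinearEquiv.toSpanNonzeroSingleton F _ _ hr0).trans
      (LinearEquiv.ofTop _ (by
        refine Submodule.eq_top_of_finrank_eq ?_
        rw [finrank_span_singleton hr0]; omega)))).trans
      (Submodule.prodEquivOfIsCompl _ _ hW.symm)
  have hE : ∀ x, E x = x.1 + x.2 • r := fun x => by simp [E]
  have hpol : ∀ w, polar Q r w = 0 := fun w => LinearMap.congr_fun (LinearMap.mem_ker.1 hr) w
  have hQr : Q r ≠ 0 := fun h0 => hr0 (Subtype.ext (isNonsingular_iff.1 hQ r h0 hpol))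
  let e : (Q.comp E.toLinearMap).IsometryEquiv Q := { E with map_app' := fun _ => rfl }
  obtain ⟨f⟩ := nonempty_orthogonalGroup_prod_line_mulEquiv (Q := Q.comp E.toLinearMap)
    (Q₁ := Q.comp W.subtype) (a := Q r) (b := b)
    (fun w c => by
      have : polar Q (w : V) (c • r) = 0 := by rw [polar_comm, polar_smul_left, hpol, smul_zero]
      simp [hE, apply_add, this, QuadraticMap.map_smul, pow_two])
    hQr (separatingLeft_restrict_of_isCompl hW) (isNonsingular_of_isometryEquiv e.symm hQ) hb
  exact ⟨(orthogonalGroupCongr e).symm.trans f⟩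

/-! ### Hyperbolic pairs and orthogonal sums with a hyperbolic plane -/

section HypExt

variable {F V W : Type*} [Field F] [AddCommGroup V] [Module F V] [AddCommGroup W] [Module F W]

/-- The orthogonal sum of a hyperbolic plane and a quadratic space. -/
def hypExt (Q : QuadraticForm F W) : QuadraticForm F (F × F × W) :=
  linMulLin (LinearMap.fst F F (F × W)) (LinearMap.fst F F W ∘ₗ LinearMap.snd F F (F × W)) +
    Q.comp (LinearMap.snd F F W ∘ₗ LinearMap.snd F F (F × W))

theorem hypExt_apply (Q : QuadraticForm F W) (x : F × F × W) :
    hypExt Q x = x.1 * x.2.1 + Q x.2.2 := rfl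

theorem polar_hypExt (Q : QuadraticForm F W) (x y : F × F × W) :
    polar (hypExt Q) x y = x.1 * y.2.1 + x.2.1 * y.1 + polar Q x.2.2 y.2.2 := by
  simp only [polar, hypExt_apply, Prod.fst_add, Prod.snd_add]
  ring

theorem isNonsingular_hypExt {Q : QuadraticForm F W} (hQ : IsNonsingular Q) :
    IsNonsingular (hypExt Q) := by
  rw [isNonsingular_iff] at *
  rintro ⟨a, b, w⟩ h0 h
  have ha : a = 0 := by simpa [polar_hypExt] using h (0, 1, 0)
  have hb : b = 0 := by simpa [polar_hypExt] using h (1, 0, 0)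
  subst ha hb
  have hw : w = 0 := hQ w (by simpa [hypExt_apply] using h0) fun w' => by
    simpa [polar_hypExt] using h (0, 0, w')
  rw [hw]; rfl

theorem separatingLeft_hypExt {Q : QuadraticForm F W} (hQ : Q.polarBilin.SeparatingLeft) :
    (hypExt Q).polarBilin.SeparatingLeft := by
  rintro ⟨a, b, w⟩ h
  have h : ∀ y, polar (hypExt Q) (a, b, w) y = 0 := h
  have ha : a = 0 := by simpa [polar_hypExt] using h (0, 1, 0)
  have hb : b = 0 := by simpa [polar_hypExt] using h (1, 0, 0)
  have hw : w = 0 := hQ w fun w' => by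
    simpa [polar_hypExt] using h (0, 0, w')
  rw [ha, hb, hw]; rfl

theorem IsPlusType.hypExt [FiniteDimensional F W] {Q : QuadraticForm F W} (hQ : IsPlusType Q) :
    IsPlusType (hypExt Q) := by
  obtain ⟨T, hT, hd⟩ := hQ
  let f : (F × T) →ₗ[F] (F × F × W) :=
    (LinearMap.fst F F T).prod ((0 : F × T →ₗ[F] F).prod (T.subtype ∘ₗ LinearMap.snd F F T))
  have hf : Function.Injective f := by
    rintro ⟨a, t⟩ ⟨b, s⟩ h
    simpa [f] using h
  refine ⟨LinearMap.range f, ?_, ?_⟩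
  · rintro _ ⟨⟨a, t⟩, rfl⟩
    simp [f, hypExt_apply, hT t t.2]
  · rw [LinearMap.finrank_range_of_inj hf]
    simp only [Module.finrank_prod, Module.finrank_self]
    omega

theorem IsPlusType.of_isometryEquiv {Q : QuadraticForm F V} {Q' : QuadraticForm F W}
    (hQ : IsPlusType Q) (e : Q.IsometryEquiv Q') : IsPlusType Q' := by
  obtain ⟨T, hT, hd⟩ := hQ
  refine ⟨T.map e.toLinearEquiv.toLinearMap, ?_, ?_⟩
  · rintro _ ⟨t, ht, rfl⟩
    exact (e.map_app t).trans (hT t ht)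
  · rw [LinearEquiv.finrank_map_eq, hd, e.toLinearEquiv.finrank_eq]

theorem polar_isometryEquiv {Q : QuadraticForm F V} {Q' : QuadraticForm F W}
    (e : Q.IsometryEquiv Q') (x y : V) : polar Q' (e x) (e y) = polar Q x y := by
  simp only [polar, ← map_add, e.map_app]

/-- Hyperbolic pairs: two singular vectors whose polar product is one. -/
def IsHypPair (Q : QuadraticForm F V) (u v : V) : Prop :=
  Q u = 0 ∧ Q v = 0 ∧ polar Q u v = 1

/-- The restriction of a quadratic form to the orthogonal complement of two vectors. -/
abbrev perpForm (Q : QuadraticForm F V) (u v : V) :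
    QuadraticForm F (pairPerp Q.polarBilin u v) :=
  Q.comp (pairPerp Q.polarBilin u v).subtype

/-- The isometry extending an isometry of the complements by the identity. -/
def hypExtMap {Q : QuadraticForm F V} {Q' : QuadraticForm F W} (e : Q.IsometryEquiv Q') :
    (hypExt Q).IsometryEquiv (hypExt Q') where
  toLinearEquiv := (LinearEquiv.refl F F).prodCongr
    ((LinearEquiv.refl F F).prodCongr e.toLinearEquiv)
  map_app' x := by
    change hypExt Q' (x.1, x.2.1, e x.2.2) = _
    simp [hypExt_apply]

theorem hypExtMap_apply {Q : QuadraticForm F V} {Q' : QuadraticForm F W}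
    (e : Q.IsometryEquiv Q') (x : F × F × V) : hypExtMap e x = (x.1, x.2.1, e x.2.2) := rfl

variable [CharP F 2]

/-- A hyperbolic pair splits off a hyperbolic plane. -/
def hypSplit {Q : QuadraticForm F V} {u v : V} (h : IsHypPair Q u v) :
    (hypExt (perpForm Q u v)).IsometryEquiv Q where
  toLinearEquiv := pairSplit Q.polarBilin (isAlt_polarBilin Q) u v h.2.2
  map_app' x := by
    obtain ⟨a, b, w, hw⟩ := x
    have hw' := mem_pairPerp.1 hw
    simp only [polarBilin_apply_apply] at hw'
    change Q (a • u + b • v + w) = a * b + Q w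
    rw [apply_add, apply_add, polar_add_left, polar_smul_left, polar_smul_left, polar_smul_left,
      hw'.1, hw'.2, polar_smul_right, h.2.2, QuadraticMap.map_smul, QuadraticMap.map_smul,
      h.1, h.2.1]
    simp

theorem hypSplit_apply {Q : QuadraticForm F V} {u v : V} (h : IsHypPair Q u v)
    (x : F × F × pairPerp Q.polarBilin u v) :
    hypSplit h x = x.1 • u + x.2.1 • v + x.2.2 := rfl

theorem exists_isHypPair {Q : QuadraticForm F V} (hQ : Q.polarBilin.SeparatingLeft) {u : V}
    (hu : u ≠ 0) (hu0 : Q u = 0) : ∃ v, IsHypPair Q u v := by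
  obtain ⟨v, hv⟩ := exists_bilin_eq_one hQ hu
  rw [polarBilin_apply_apply] at hv
  -- Adding c • u to `v` changes Q(v) by c and leaves the polar product with `u` unchanged; c = Q(v)
  -- makes the vector singular in characteristic two.
  refine ⟨v + Q v • u, hu0, ?_, ?_⟩
  · rw [apply_add, QuadraticMap.map_smul, polar_smul_right, polar_comm, hv, hu0]
    simp [CharTwo.add_self_eq_zero]
  · rw [polar_add_right, polar_smul_right, hv, polar_self, hu0]
    simp

theorem separatingLeft_perpForm {Q : QuadraticForm F V} (hQ : Q.polarBilin.SeparatingLeft)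
    {u v : V} (h : IsHypPair Q u v) : (perpForm Q u v).polarBilin.SeparatingLeft :=
  separatingLeft_pairPerp (isAlt_polarBilin Q) hQ h.2.2

theorem finrank_perp [FiniteDimensional F V] {Q : QuadraticForm F V} {u v : V}
    (h : IsHypPair Q u v) :
    Module.finrank F V = Module.finrank F (pairPerp Q.polarBilin u v) + 2 :=
  finrank_pairPerp _ (isAlt_polarBilin Q) u v h.2.2

/-- A form of plus type in positive dimension splits off a hyperbolic plane with complement of
plus type. -/
theorem IsPlusType.exists_perpForm [FiniteDimensional F V] [Nontrivial V] {Q : QuadraticForm F V}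
    (hQ : IsPlusType Q) (hnd : Q.polarBilin.SeparatingLeft) :
    ∃ u v, IsHypPair Q u v ∧ IsPlusType (perpForm Q u v) := by
  obtain ⟨T, hT, hd⟩ := hQ
  have hpos : 0 < Module.finrank F T := by
    have := Module.finrank_pos (R := F) (M := V); omega
  have : Nontrivial T := Module.finrank_pos_iff.1 hpos
  obtain ⟨⟨u, huT⟩, hu⟩ := exists_ne (0 : T)
  obtain ⟨v, h⟩ := exists_isHypPair hnd (fun h => hu (Subtype.ext h)) (hT u huT)
  refine ⟨u, v, h, ?_⟩
  -- All of `T` is orthogonal to `u`, so the hyperplane of `T` orthogonal to `v` lies in the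
  -- complement of the pair and has half its dimension.
  let f : T →ₗ[F] F := Q.polarBilin v ∘ₗ T.subtype
  have hf : Function.Surjective f := fun c => ⟨c • ⟨u, huT⟩, by
    simp [f, polar_comm Q v u, h.2.2]⟩
  have hpol : ∀ t ∈ T, polar Q u t = 0 := fun t ht => by
    rw [polar, hT _ (T.add_mem huT ht), hT _ huT, hT _ ht]; simp
  let g : LinearMap.ker f →ₗ[F] pairPerp Q.polarBilin u v :=
    (T.subtype ∘ₗ (LinearMap.ker f).subtype).codRestrict _ fun t =>
      mem_pairPerp.2 ⟨hpol _ t.1.2, t.2⟩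
  have hg : Function.Injective g := fun s t hst => by
    have : (g s : V) = g t := congrArg Subtype.val hst
    exact Subtype.ext (Subtype.ext this)
  refine ⟨LinearMap.range g, ?_, ?_⟩
  · rintro _ ⟨t, rfl⟩
    exact hT _ t.1.2
  · rw [LinearMap.finrank_range_of_inj hg]
    have h1 : 1 + Module.finrank F (LinearMap.ker f) = Module.finrank F T := by
      rw [← LinearMap.finrank_range_add_finrank_ker f, LinearMap.range_eq_top.2 hf, finrank_top,
        Module.finrank_self]
    have h2 := finrank_perp h
    rw [h2, ← h1] at hd
    change 2 * Module.finrank F (LinearMap.ker f) = _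
    linarith

end HypExt

/-! ### Existence of singular vectors -/

section Singular

variable {F V : Type*} [Field F] [Fintype F] [CharP F 2] [AddCommGroup V] [Module F V]

/-- In dimension at least three every quadratic form has a nontrivial singular vector. -/
theorem exists_singular [FiniteDimensional F V] (Q : QuadraticForm F V)
    (h : 3 ≤ Module.finrank F V) : ∃ u, u ≠ 0 ∧ Q u = 0 := by
  have : Nontrivial V := Module.finrank_pos_iff (R := F).1 (by omega)
  obtain ⟨u, hu⟩ := exists_ne (0 : V)
  by_cases hu0 : Q u = 0
  · exact ⟨u, hu, hu0⟩
  -- The vectors orthogonal to `u` form a space of dimension at least two, so one of them, `w`, is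
  -- independent of `u`. On the span of `u` and `w` the form is additive, and a square root gives a
  -- singular c • u + w.
  have hlt : Module.finrank F (F ∙ u) < Module.finrank F (LinearMap.ker (Q.polarBilin u)) := by
    have h1 := LinearMap.finrank_range_add_finrank_ker (Q.polarBilin u)
    have h2 := Submodule.finrank_le (LinearMap.range (Q.polarBilin u))
    rw [Module.finrank_self] at h2
    rw [finrank_span_singleton hu]
    omega
  obtain ⟨w, hw, hwu⟩ : ∃ w ∈ LinearMap.ker (Q.polarBilin u), w ∉ F ∙ u := by
    by_contra! hc
    exact absurd (Submodule.finrank_mono hc) (by omega)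
  obtain ⟨c, hc⟩ := (frobeniusEquiv F 2).surjective (Q w / Q u)
  rw [frobeniusEquiv_def, eq_div_iff hu0] at hc
  refine ⟨c • u + w, fun h0 => hwu ?_, ?_⟩
  · rw [Submodule.mem_span_singleton]
    exact ⟨-c, by rw [neg_smul, ← eq_neg_of_add_eq_zero_right h0]⟩
  · have hp : polar Q u w = 0 := hw
    rw [apply_add, polar_smul_left, hp, QuadraticMap.map_smul, smul_eq_mul, ← pow_two, hc,
      smul_zero, add_zero, CharTwo.add_self_eq_zero]

end Singular

/-! ### Counting singular vectors and hyperbolic pairs -/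

section Count

variable {F V W : Type*} [Field F] [Fintype F] [AddCommGroup V] [Module F V]
  [AddCommGroup W] [Module F W]

theorem two_le_card : (2 : ℤ) ≤ Fintype.card F := by
  exact_mod_cast Fintype.one_lt_card (α := F)

theorem natCard_eq_mul_of_fibers {α β : Type*} [Finite α] [Finite β] (f : α → β) (c : ℕ)
    (h : ∀ b, Nat.card {a // f a = b} = c) : Nat.card α = Nat.card β * c := by
  have := Fintype.ofFinite β
  rw [← Nat.card_congr (Equiv.sigmaFiberEquiv f), Nat.card_sigma, Finset.sum_congr rfl
    (fun b _ => h b), Finset.sum_const, smul_eq_mul, Nat.card_eq_fintype_card, Finset.card_univ]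

/-- The singular vectors of `hypExt Q`. -/
noncomputable def singularHypExtEquiv (Q : QuadraticForm F W) :
    {x // hypExt Q x = 0} ≃ (F × {w // Q w = 0}) ⊕ (Fˣ × W) := by
  classical
  exact
  { toFun := fun x => if h : x.1.2.1 = 0 then
        Sum.inl (x.1.1, ⟨x.1.2.2, by have := x.2; rwa [hypExt_apply, h, mul_zero, zero_add] at this⟩)
      else Sum.inr (Units.mk0 _ h, x.1.2.2)
    invFun := Sum.elim (fun y => ⟨(y.1, 0, y.2), by simp [hypExt_apply, y.2.2]⟩)
      (fun y => ⟨(-Q y.2 / y.1, y.1, y.2), by simp [hypExt_apply]⟩)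
    left_inv := by
      rintro ⟨⟨a, b, w⟩, h⟩
      rw [hypExt_apply] at h
      by_cases hb : b = 0
      · simp [hb]
      · have h' : -Q w / b = a := by
          rw [div_eq_iff hb]; linear_combination -h
        simp [hb, h']
    right_inv := by
      rintro (⟨a, w, hw⟩ | ⟨b, w⟩) <;> simp }

theorem natCard_singular_hypExt [FiniteDimensional F W] (Q : QuadraticForm F W) :
    (Nat.card {x // hypExt Q x = 0} : ℤ) = Fintype.card F * Nat.card {w // Q w = 0} +
      (Fintype.card F - 1) * (Fintype.card F : ℤ) ^ Module.finrank F W := by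
  have := Module.finite_of_finite F (M := W)
  rw [Nat.card_congr (singularHypExtEquiv Q), Nat.card_sum, Nat.card_prod, Nat.card_prod,
    Module.natCard_eq_pow_finrank (K := F) (V := W), Nat.card_eq_fintype_card (α := F),
    Nat.card_units, Nat.card_eq_fintype_card (α := F)]
  have := Fintype.card_pos (α := F)
  push_cast [Nat.cast_sub this]
  ring

open Classical in
/-- The sign of a quadratic form: `1` for plus type and `-1` otherwise. -/
noncomputable def typeSign (Q : QuadraticForm F V) : ℤ := if IsPlusType Q then 1 else -1

omit [Fintype F] in
theorem typeSign_mul_self (Q : QuadraticForm F V) : typeSign Q * typeSign Q = 1 := by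
  unfold typeSign; split_ifs <;> norm_num

omit [Fintype F] in
theorem typeSign_eq_iff {Q : QuadraticForm F V} {Q' : QuadraticForm F W} :
    typeSign Q = typeSign Q' ↔ (IsPlusType Q ↔ IsPlusType Q') := by
  unfold typeSign; split_ifs <;> simp_all

omit [Fintype F] in
theorem typeSign_congr {Q : QuadraticForm F V} {Q' : QuadraticForm F W}
    (e : Q.IsometryEquiv Q') : typeSign Q = typeSign Q' :=
  typeSign_eq_iff.2 ⟨fun h => h.of_isometryEquiv e, fun h => h.of_isometryEquiv e.symm⟩

omit [Fintype F] in
theorem natCard_singular_congr {Q : QuadraticForm F V} {Q' : QuadraticForm F W}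
    (e : Q.IsometryEquiv Q') : Nat.card {v // Q v = 0} = Nat.card {w // Q' w = 0} :=
  Nat.card_congr (e.toLinearEquiv.toEquiv.subtypeEquiv fun v => by
    rw [← e.map_app v]; rfl)

theorem natCard_singular_aux {q N N' d s : ℤ} {m : ℕ} (hN : N = q * N' + (q - 1) * d)
    (hd : d = q ^ (2 * m)) (hN' : q * N' = q ^ (2 * m) + s * (q - 1) * q ^ m) :
    q * N = q ^ (2 * (m + 1)) + s * (q - 1) * q ^ (m + 1) := by
  rw [hN, mul_add, hN', hd]; ring

/-- The number of singular vectors depends only on the dimension and the type. -/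
theorem natCard_singular {F : Type*} [Field F] [Fintype F] [CharP F 2] (m : ℕ) :
    ∀ {V : Type*} [AddCommGroup V] [Module F V] [FiniteDimensional F V] {Q : QuadraticForm F V},
      Q.polarBilin.SeparatingLeft → Module.finrank F V = 2 * m →
      (Fintype.card F : ℤ) * Nat.card {v // Q v = 0} = (Fintype.card F : ℤ) ^ (2 * m) +
        typeSign Q * (Fintype.card F - 1) * (Fintype.card F : ℤ) ^ m := by
  induction m with
  | zero =>
    intro V _ _ _ Q hnd hd
    have : Subsingleton V := Module.finrank_zero_iff.1 hd
    have h1 : IsPlusType Q := ⟨⊥, fun w hw => by rw [(Submodule.mem_bot F).1 hw, map_zero],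
      by rw [finrank_bot, hd]⟩
    have h2 : Nat.card {v // Q v = 0} = 1 := by
      rw [Nat.card_eq_one_iff_unique]
      exact ⟨inferInstance, ⟨0, map_zero Q⟩⟩
    rw [h2, typeSign, if_pos h1]
    simp
  | succ m ih =>
    intro V _ _ _ Q hnd hd
    have : Nontrivial V := Module.finrank_pos_iff (R := F).1 (by omega)
    -- Invariance of the sign under splitting is a consequence of this count and is not available
    -- here, so a pair with the right sign is asked for. If there is none, `Q` is not of plus type;
    -- a complement of plus type would make `Q` so, hence there is no hyperbolic pair at all and `Q`
    -- is an anisotropic plane.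
    by_cases h : ∃ u v, IsHypPair Q u v ∧ typeSign (perpForm Q u v) = typeSign Q
    · obtain ⟨u, v, huv, hs⟩ := h
      have hd' : Module.finrank F (pairPerp Q.polarBilin u v) = 2 * m := by
        have := finrank_perp huv; omega
      rw [← natCard_singular_congr (hypSplit huv)]
      refine natCard_singular_aux (natCard_singular_hypExt _) (by rw [hd']) ?_
      rw [← hs]
      exact ih (separatingLeft_perpForm hnd huv) hd'
    · have hplus : ¬ IsPlusType Q := fun hp => by
        obtain ⟨u, v, huv, hp'⟩ := hp.exists_perpForm hnd
        exact h ⟨u, v, huv, typeSign_eq_iff.2 (iff_of_true hp' hp)⟩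
      have hanis : ∀ u, Q u = 0 → u = 0 := fun u hu => by
        by_contra hu0
        obtain ⟨v, huv⟩ := exists_isHypPair hnd hu0 hu
        refine h ⟨u, v, huv, typeSign_eq_iff.2 (iff_of_false (fun hp => hplus ?_) hplus)⟩
        exact hp.hypExt.of_isometryEquiv (hypSplit huv)
      have hm : m = 0 := by
        by_contra hm
        obtain ⟨u, hu, hu0⟩ := exists_singular Q (by omega)
        exact hu (hanis u hu0)
      have h2 : Nat.card {v // Q v = 0} = 1 := by
        rw [Nat.card_eq_one_iff_unique]
        exact ⟨⟨fun a b => Subtype.ext ((hanis _ a.2).trans (hanis _ b.2).symm)⟩, ⟨0, map_zero Q⟩⟩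
      rw [h2, typeSign, if_neg hplus, hm]
      push_cast; ring

variable [CharP F 2]

/-- The singular vectors of `hypExt Q` are counted twice, from those of `Q` and from the type of
`hypExt Q`; the sign can be read off because its coefficient is not zero. -/
theorem typeSign_hypExt [FiniteDimensional F W] {Q : QuadraticForm F W} {m : ℕ}
    (hQ : Q.polarBilin.SeparatingLeft) (hW : Module.finrank F W = 2 * m) :
    typeSign (hypExt Q) = typeSign Q := by
  have h1 := natCard_singular_aux (natCard_singular_hypExt Q) (by rw [hW])
    (natCard_singular m hQ hW)
  have h2 := natCard_singular (m + 1) (separatingLeft_hypExt hQ)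
    (by simp only [Module.finrank_prod, Module.finrank_self]; omega)
  rw [h1, add_right_inj, mul_assoc, mul_assoc] at h2
  have hq := two_le_card (F := F)
  exact (mul_right_cancel₀ (mul_ne_zero (by omega) (pow_ne_zero _ (by omega))) h2).symm

theorem typeSign_perpForm [FiniteDimensional F V] {Q : QuadraticForm F V} {m : ℕ}
    (hQ : Q.polarBilin.SeparatingLeft) (hV : Module.finrank F V = 2 * (m + 1)) {u v : V}
    (h : IsHypPair Q u v) : typeSign (perpForm Q u v) = typeSign Q := by
  rw [← typeSign_hypExt (separatingLeft_perpForm hQ h) (m := m)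
    (by have := finrank_perp h; omega)]
  exact typeSign_congr (hypSplit h)

/-- The number of vectors completing a singular vector to a hyperbolic pair. -/
theorem natCard_isHypPair_left [FiniteDimensional F V] {Q : QuadraticForm F V} {m : ℕ}
    (hQ : Q.polarBilin.SeparatingLeft) (hV : Module.finrank F V = 2 * (m + 1)) {u : V}
    (hu : u ≠ 0) (hu0 : Q u = 0) :
    Nat.card {v // IsHypPair Q u v} = Fintype.card F ^ (2 * m) := by
  obtain ⟨v, h⟩ := exists_isHypPair hQ hu hu0
  have hd : Module.finrank F (pairPerp Q.polarBilin u v) = 2 * m := by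
    have := finrank_perp h; omega
  rw [← hd, ← Nat.card_eq_fintype_card, ← Module.natCard_eq_pow_finrank (K := F)]
  let e := hypSplit h
  have he : e (1, 0, 0) = u := by simp [e, hypSplit_apply]
  have hpol : ∀ x, polar Q u (e x) = x.2.1 := fun x => by
    refine (congrArg (polar Q · (e x)) he.symm).trans ((polar_isometryEquiv e _ _).trans ?_)
    rw [polar_hypExt]
    simp
  -- In coordinates (a, b, w), polar product one with `u` means b = 1, and being singular then
  -- forces a = Q(w); only `w` is free.
  let f : pairPerp Q.polarBilin u v → {v // IsHypPair Q u v} := fun w =>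
    ⟨e (Q w, 1, w), hu0, by
      rw [e.map_app, hypExt_apply, mul_one]; exact CharTwo.add_self_eq_zero _, hpol _⟩
  refine (Nat.card_congr (Equiv.ofBijective f ⟨fun w w' hw => ?_, fun ⟨y, hy⟩ => ?_⟩)).symm
  · have := e.injective (congrArg Subtype.val hw)
    exact congrArg (fun x => x.2.2) this
  · obtain ⟨⟨a, b, w⟩, rfl⟩ := e.surjective y
    have hb : b = 1 := (hpol _).symm.trans hy.2.2
    have ha : a * b + Q w = 0 := (e.map_app (a, b, w)).symm.trans hy.2.1
    refine ⟨w, Subtype.ext ?_⟩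
    rw [hb, mul_one, CharTwo.add_eq_zero] at ha
    exact congrArg e (show (_, _, _) = (_, _, _) by rw [hb, ha])

/-- The number of hyperbolic pairs. -/
theorem natCard_isHypPair [FiniteDimensional F V] {Q : QuadraticForm F V} {m : ℕ}
    (hQ : Q.polarBilin.SeparatingLeft) (hV : Module.finrank F V = 2 * (m + 1)) :
    (Nat.card {p : V × V // IsHypPair Q p.1 p.2} : ℤ) =
      ((Fintype.card F : ℤ) ^ (m + 1) - typeSign Q) * ((Fintype.card F : ℤ) ^ m + typeSign Q) *
        (Fintype.card F : ℤ) ^ (2 * m) := by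
  classical
  have := Module.finite_of_finite F (M := V)
  have := Fintype.ofFinite V
  let f : {p : V × V // IsHypPair Q p.1 p.2} → {u // Q u = 0 ∧ u ≠ 0} := fun p =>
    ⟨p.1.1, p.2.1, fun h0 => by
      have := p.2.2.2
      simp [h0] at this⟩
  have h1 : ∀ u, Nat.card {p // f p = u} = Fintype.card F ^ (2 * m) := fun ⟨u, hu0, hu⟩ => by
    rw [← natCard_isHypPair_left hQ hV hu hu0]
    refine Nat.card_congr
      { toFun := fun p => ⟨p.1.1.2, by
          have h : p.1.1.1 = u := congrArg Subtype.val p.2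
          exact (congrArg (IsHypPair Q · p.1.1.2) h).mp p.1.2⟩
        invFun := fun v => ⟨⟨(u, v), v.2⟩, rfl⟩
        left_inv := ?_
        right_inv := fun v => rfl }
    rintro ⟨⟨⟨a, b⟩, hp⟩, h⟩
    have h : a = u := congrArg Subtype.val h
    subst h; rfl
  have h2 : Nat.card {v // Q v = 0} = Nat.card {u // Q u = 0 ∧ u ≠ 0} + 1 := by
    rw [Nat.card_eq_fintype_card, Nat.card_eq_fintype_card, Fintype.card_subtype,
      Fintype.card_subtype, ← Finset.filter_filter, Finset.filter_ne',
      Finset.card_erase_add_one (by simp)]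
  have h3 := natCard_singular (m + 1) hQ hV
  have hq := two_le_card (F := F)
  rw [natCard_eq_mul_of_fibers f _ h1]
  rw [h2] at h3
  push_cast at h3 ⊢
  refine congrArg (· * _) (mul_left_cancel₀ (show (Fintype.card F : ℤ) ≠ 0 by omega) ?_)
  linear_combination h3 + (Fintype.card F : ℤ) * typeSign_mul_self Q

end Count

/-! ### Counting isometries through hyperbolic pairs -/

section Isometries

variable {F V W : Type*} [Field F] [AddCommGroup V] [Module F V] [AddCommGroup W] [Module F W]

theorem finite_isometryEquiv [Finite V] [Finite W] (Q : QuadraticForm F V)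
    (Q' : QuadraticForm F W) : Finite (Q.IsometryEquiv Q') :=
  DFunLike.finite _

theorem natCard_isometryEquiv_congr {V₁ : Type*} [AddCommGroup V₁] [Module F V₁]
    {Q₁ : QuadraticForm F V₁} {Q : QuadraticForm F V} (Q' : QuadraticForm F W)
    (e : Q₁.IsometryEquiv Q) :
    Nat.card (Q.IsometryEquiv Q') = Nat.card (Q₁.IsometryEquiv Q') :=
  Nat.card_congr
    { toFun := fun f => e.trans f
      invFun := fun f => e.symm.trans f
      left_inv := fun f => DFunLike.ext _ _ fun x => congrArg f (e.apply_symm_apply x)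
      right_inv := fun f => DFunLike.ext _ _ fun x => congrArg f (e.symm_apply_apply x) }

theorem natCard_orthogonalGroup (Q : QuadraticForm F V) :
    Nat.card (orthogonalGroup Q) = Nat.card (Q.IsometryEquiv Q) :=
  Nat.card_congr
    { toFun := fun g => { g.1 with map_app' := g.2 }
      invFun := fun e => ⟨e.toLinearEquiv, e.map_app⟩
      left_inv := fun _ => rfl
      right_inv := fun _ => rfl }

theorem isHypPair_map {Q : QuadraticForm F V} {Q' : QuadraticForm F W} (e : Q.IsometryEquiv Q')
    {u v : V} (h : IsHypPair Q u v) : IsHypPair Q' (e u) (e v) :=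
  ⟨(e.map_app u).trans h.1, (e.map_app v).trans h.2.1, (polar_isometryEquiv e u v).trans h.2.2⟩

theorem isHypPair_hypExt (Q : QuadraticForm F V) :
    IsHypPair (hypExt Q) (1, 0, 0) (0, 1, 0) := by
  refine ⟨?_, ?_, ?_⟩ <;> simp [hypExt_apply, polar_hypExt]

/-- An isometry fixing the standard hyperbolic pair preserves its complement. -/
theorem apply_eq_of_fixes {Q : QuadraticForm F V} {Q' : QuadraticForm F W}
    {g : (hypExt Q).IsometryEquiv (hypExt Q')} (h1 : g (1, 0, 0) = (1, 0, 0))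
    (h2 : g (0, 1, 0) = (0, 1, 0)) (w : V) : g (0, 0, w) = (0, 0, (g (0, 0, w)).2.2) := by
  have e1 := polar_isometryEquiv g (1, 0, 0) (0, 0, w)
  have e2 := polar_isometryEquiv g (0, 1, 0) (0, 0, w)
  rw [h1, polar_hypExt, polar_hypExt] at e1
  rw [h2, polar_hypExt, polar_hypExt] at e2
  simp only [one_mul, zero_mul, zero_add, add_zero, polar_zero_left] at e1 e2
  exact Prod.ext e2 (Prod.ext e1 rfl)

/-- The isometry of the complements induced by an isometry fixing the hyperbolic pair. -/
def restrictOfFixes {Q : QuadraticForm F V} {Q' : QuadraticForm F W}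
    (g : (hypExt Q).IsometryEquiv (hypExt Q')) (h1 : g (1, 0, 0) = (1, 0, 0))
    (h2 : g (0, 1, 0) = (0, 1, 0)) : Q.IsometryEquiv Q' where
  toFun w := (g (0, 0, w)).2.2
  map_add' x y := by
    have : ((0, 0, x + y) : F × F × V) = (0, 0, x) + (0, 0, y) := by simp
    rw [this, map_add]; rfl
  map_smul' c x := by
    have : ((0, 0, c • x) : F × F × V) = c • (0, 0, x) := by simp
    rw [this, map_smul]; rfl
  invFun w := (g.symm (0, 0, w)).2.2
  left_inv w := by
    change (g.symm (0, 0, (g (0, 0, w)).2.2)).2.2 = w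
    rw [← apply_eq_of_fixes h1 h2, g.symm_apply_apply]
  right_inv w := by
    change (g (0, 0, (g.symm (0, 0, w)).2.2)).2.2 = w
    rw [← apply_eq_of_fixes (g := g.symm) (g.symm_apply_eq.2 h1.symm) (g.symm_apply_eq.2 h2.symm),
      g.apply_symm_apply]
  map_app' w := by
    have h := g.map_app (0, 0, w)
    rw [apply_eq_of_fixes h1 h2, hypExt_apply, hypExt_apply] at h
    simpa using h

theorem hypExtMap_restrictOfFixes {Q : QuadraticForm F V} {Q' : QuadraticForm F W}
    (g : (hypExt Q).IsometryEquiv (hypExt Q')) (h1 : g (1, 0, 0) = (1, 0, 0))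
    (h2 : g (0, 1, 0) = (0, 1, 0)) (x : F × F × V) :
    hypExtMap (restrictOfFixes g h1 h2) x = g x := by
  obtain ⟨a, b, w⟩ := x
  have : ((a, b, w) : F × F × V) = a • (1, 0, 0) + b • (0, 1, 0) + (0, 0, w) := by simp
  rw [this, map_add g, map_add g, map_smul, map_smul, h1, h2, apply_eq_of_fixes h1 h2 w,
    hypExtMap_apply]
  simp [restrictOfFixes]
  rfl

variable [CharP F 2]

/-- Isometries with prescribed values on a hyperbolic pair. -/
theorem natCard_isometryEquiv_fiber {Q₁ : QuadraticForm F W} {Q : QuadraticForm F V} {u v : V}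
    (h : IsHypPair Q u v) :
    Nat.card {e : (hypExt Q₁).IsometryEquiv Q // e (1, 0, 0) = u ∧ e (0, 1, 0) = v} =
      Nat.card (Q₁.IsometryEquiv (perpForm Q u v)) := by
  have hu : hypSplit h (1, 0, 0) = u := by simp [hypSplit_apply]
  have hv : hypSplit h (0, 1, 0) = v := by simp [hypSplit_apply]
  let f : Q₁.IsometryEquiv (perpForm Q u v) →
      {e : (hypExt Q₁).IsometryEquiv Q // e (1, 0, 0) = u ∧ e (0, 1, 0) = v} := fun g =>
    ⟨(hypExtMap g).trans (hypSplit h), by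
      refine ⟨Eq.trans (congrArg (hypSplit h) ?_) hu, Eq.trans (congrArg (hypSplit h) ?_) hv⟩
      · change hypExtMap g _ = _; rw [hypExtMap_apply, map_zero]
      · change hypExtMap g _ = _; rw [hypExtMap_apply, map_zero]⟩
  refine (Nat.card_congr (Equiv.ofBijective f ⟨fun g g' hg => ?_, fun ⟨e, he1, he2⟩ => ?_⟩)).symm
  · refine DFunLike.ext _ _ fun w => ?_
    have := DFunLike.congr_fun (congrArg Subtype.val hg) (0, 0, w)
    have := (hypSplit h).injective this
    exact congrArg (fun x => x.2.2) this
  · refine ⟨restrictOfFixes (e.trans (hypSplit h).symm) ?_ ?_, Subtype.ext ?_⟩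
    · exact (hypSplit h).symm_apply_eq.2 (he1.trans hu.symm)
    · exact (hypSplit h).symm_apply_eq.2 (he2.trans hv.symm)
    · refine DFunLike.ext _ _ fun x => ?_
      exact (congrArg (hypSplit h) (hypExtMap_restrictOfFixes _ _ _ x)).trans
        ((hypSplit h).apply_symm_apply _)

/-- Isometries are sorted by the image of the standard hyperbolic pair; each fibre is the set of
isometries between the complements. -/
theorem natCard_isometryEquiv_hypExt [Finite V] [Finite W] [Finite F] {Q₁ : QuadraticForm F W}
    {Q : QuadraticForm F V} (c : ℕ)
    (hc : ∀ u v, IsHypPair Q u v → Nat.card (Q₁.IsometryEquiv (perpForm Q u v)) = c) :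
    Nat.card ((hypExt Q₁).IsometryEquiv Q) =
      Nat.card {p : V × V // IsHypPair Q p.1 p.2} * c := by
  have := finite_isometryEquiv (hypExt Q₁) Q
  refine natCard_eq_mul_of_fibers (fun e => ⟨(e (1, 0, 0), e (0, 1, 0)),
    isHypPair_map e (isHypPair_hypExt Q₁)⟩) c fun ⟨⟨u, v⟩, h⟩ => ?_
  rw [← hc u v h, ← natCard_isometryEquiv_fiber h]
  exact Nat.card_congr (Equiv.subtypeEquivRight fun e => by simp)

end Isometries

/-! ### The anisotropic plane and the Artin–Schreier map -/

section AnisotropicPlane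

variable {F V : Type*} [Field F] [AddCommGroup V] [Module F V]

theorem anisotropic_of_isometryEquiv {W : Type*} [AddCommGroup W] [Module F W]
    {Q : QuadraticForm F V} {Q' : QuadraticForm F W} (hQ : Q.Anisotropic)
    (e : Q'.IsometryEquiv Q) : Q'.Anisotropic := fun w hw => by
  have := hQ (e w) ((e.map_app w).trans hw)
  rw [← e.symm_apply_apply w, this, map_zero]

/-- The binary form `x² + x y + a y²`. -/
def normPlane (a : F) : QuadraticForm F (F × F) :=
  linMulLin (LinearMap.fst F F F) (LinearMap.fst F F F + LinearMap.snd F F F) +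
    a • linMulLin (LinearMap.snd F F F) (LinearMap.snd F F F)

theorem normPlane_apply (a : F) (x : F × F) :
    normPlane a x = x.1 ^ 2 + x.1 * x.2 + a * x.2 ^ 2 := by
  simp [normPlane]; ring

variable [CharP F 2]

theorem polar_normPlane (a : F) (x y : F × F) :
    polar (normPlane a) x y = x.1 * y.2 + x.2 * y.1 := by
  simp only [polar, normPlane_apply, Prod.fst_add, Prod.snd_add]
  linear_combination (x.1 * y.1 + a * x.2 * y.2) * (CharTwo.two_eq_zero (R := F))

theorem isNonsingular_normPlane (a : F) : IsNonsingular (normPlane a) := by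
  rw [isNonsingular_iff]
  rintro ⟨x, y⟩ - h
  have h1 : x = 0 := by simpa [polar_normPlane] using h (0, 1)
  have h2 : y = 0 := by simpa [polar_normPlane] using h (1, 0)
  rw [h1, h2]; rfl

/-- The additive map `x ↦ x² + x` in characteristic two. -/
def artinSchreier (F : Type*) [Field F] [CharP F 2] : F →+ F where
  toFun x := x ^ 2 + x
  map_zero' := by simp
  map_add' x y := by rw [CharTwo.add_sq]; ring

theorem artinSchreier_apply (x : F) : artinSchreier F x = x ^ 2 + x := rfl

theorem mem_ker_artinSchreier {x : F} : x ∈ (artinSchreier F).ker ↔ x = 0 ∨ x = 1 := by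
  rw [AddMonoidHom.mem_ker, artinSchreier_apply, show x ^ 2 + x = x * (x + 1) by ring,
    mul_eq_zero, CharTwo.add_eq_zero]

theorem natCard_ker_artinSchreier : Nat.card (artinSchreier F).ker = 2 := by
  have : ((artinSchreier F).ker : Set F) = {0, 1} := by
    ext x; simp [← mem_ker_artinSchreier]
  rw [← SetLike.coe_sort_coe, this, Nat.card_coe_set_eq, Set.ncard_pair zero_ne_one]

theorem index_range_artinSchreier [Finite F] : (artinSchreier F).range.index = 2 := by
  have h1 := AddSubgroup.card_mul_index (artinSchreier F).range
  have h2 := AddSubgroup.card_mul_index (artinSchreier F).ker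
  rw [AddSubgroup.index_ker, natCard_ker_artinSchreier, ← h1, mul_comm 2] at h2
  exact (Nat.eq_of_mul_eq_mul_left Nat.card_pos h2).symm

/-- Two elements outside a subgroup of index two have their sum inside it, and the solutions form a
coset of the kernel {0, 1}. -/
theorem natCard_artinSchreier_eq [Finite F] {a b : F} (ha : a ∉ (artinSchreier F).range)
    (hb : b ∉ (artinSchreier F).range) : Nat.card {c : F // c ^ 2 + c = a + b} = 2 := by
  have hab : a + b ∈ (artinSchreier F).range :=
    (AddSubgroup.add_mem_iff_of_index_two index_range_artinSchreier).2 (iff_of_false ha hb)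
  obtain ⟨d, hd⟩ := hab
  refine (Nat.card_congr ((Equiv.addRight (-d)).subtypeEquiv fun c => ?_)).trans
    natCard_ker_artinSchreier
  rw [← hd, ← artinSchreier_apply, Equiv.coe_addRight, AddMonoidHom.mem_ker, map_add, map_neg,
    ← sub_eq_add_neg, sub_eq_zero]

theorem exists_notMem_range_artinSchreier [Finite F] : ∃ a : F, a ∉ (artinSchreier F).range := by
  by_contra! h
  have h1 := index_range_artinSchreier (F := F)
  rw [(AddSubgroup.eq_top_iff' _).2 h, AddSubgroup.index_top] at h1
  omega

theorem normPlane_anisotropic {a : F} (ha : a ∉ (artinSchreier F).range) :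
    (normPlane a).Anisotropic := by
  rintro ⟨x, y⟩ h
  rw [normPlane_apply] at h
  simp only at h
  have hy : y = 0 := by
    by_contra hy
    refine ha ⟨x / y, ?_⟩
    rw [artinSchreier_apply, ← CharTwo.add_eq_zero]
    field_simp
    linear_combination h
  subst hy
  have hx : x = 0 := by simpa using h
  rw [hx]; rfl

theorem notMem_range_of_anisotropic {a : F} (h : (normPlane a).Anisotropic) :
    a ∉ (artinSchreier F).range := by
  rintro ⟨x, hx⟩
  have := h (x, 1) (by
    rw [normPlane_apply, ← hx, artinSchreier_apply]
    simp [CharTwo.add_self_eq_zero])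
  simp at this

/-- The coordinate isometry of a plane given by `u`, `v` with `Q u = 1` and polar product one. -/
noncomputable def planeIso [FiniteDimensional F V] {Q : QuadraticForm F V} {a : F}
    (hV : Module.finrank F V = 2) {u v : V} (hu : Q u = 1) (hv : Q v = a) (h : polar Q u v = 1) :
    (normPlane a).IsometryEquiv Q where
  toLinearEquiv := LinearMap.linearEquivOfInjective
    ((LinearMap.fst F F F).smulRight u + (LinearMap.snd F F F).smulRight v)
    (by
      rw [← LinearMap.ker_eq_bot, LinearMap.ker_eq_bot']
      rintro ⟨x, y⟩ h0
      replace h0 : x • u + y • v = 0 := h0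
      have h1 : y = 0 := by
        have := congrArg (polar Q u) h0
        rw [polar_add_right, polar_smul_right, polar_smul_right, h, polar_self, two_smul,
          CharTwo.add_self_eq_zero, polar_zero_right] at this
        simpa using this
      have h2 : x = 0 := by
        have := congrArg (polar Q v) h0
        rw [h1, polar_add_right, polar_smul_right, polar_comm, h, zero_smul, polar_zero_right]
          at this
        simpa using this
      rw [h1, h2]; rfl)
    (by simp [hV])
  map_app' x := by
    change Q (x.1 • u + x.2 • v) = _
    rw [normPlane_apply, apply_add, QuadraticMap.map_smul, QuadraticMap.map_smul, hu, hv,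
      polar_smul_left, polar_smul_right, h]
    simp only [smul_eq_mul]; ring

theorem planeIso_apply [FiniteDimensional F V] {Q : QuadraticForm F V} {a : F}
    (hV : Module.finrank F V = 2) {u v : V} (hu : Q u = 1) (hv : Q v = a) (h : polar Q u v = 1)
    (x : F × F) : planeIso hV hu hv h x = x.1 • u + x.2 • v := rfl

/-- Fix `v` with polar product one with `u`. The image of (0, 1) must be v + c • u with c² + c +
Q(v) = a. Anisotropy puts Q(v) outside the Artin–Schreier image, so there are two solutions c. -/
theorem natCard_planeIso_fiber [Finite F] [FiniteDimensional F V] {Q : QuadraticForm F V}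
    (hV : Module.finrank F V = 2) (hnd : Q.polarBilin.SeparatingLeft) (hQ : Q.Anisotropic)
    {a : F} (ha : a ∉ (artinSchreier F).range) {u : V} (hu : Q u = 1) :
    Nat.card {e : (normPlane a).IsometryEquiv Q // e (1, 0) = u} = 2 := by
  have hu0 : u ≠ 0 := fun h => by simp [h] at hu
  obtain ⟨v, hv⟩ := exists_bilin_eq_one hnd hu0
  rw [polarBilin_apply_apply] at hv
  let E := planeIso hV hu rfl hv
  have hb := notMem_range_of_anisotropic (anisotropic_of_isometryEquiv hQ E)
  rw [← natCard_artinSchreier_eq ha hb]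
  have h1 : ∀ c, Q (v + c • u) = c ^ 2 + c + Q v := fun c => by
    rw [apply_add, QuadraticMap.map_smul, polar_smul_right, polar_comm, hv, hu]
    simp only [smul_eq_mul]; ring
  have h2 : ∀ c : F, polar Q u (v + c • u) = 1 := fun c => by
    rw [polar_add_right, polar_smul_right, hv, polar_self, two_smul, CharTwo.add_self_eq_zero,
      smul_zero, add_zero]
  let f : {c : F // c ^ 2 + c = a + Q v} →
      {e : (normPlane a).IsometryEquiv Q // e (1, 0) = u} := fun c =>
    ⟨planeIso hV hu (a := a) (v := v + c.1 • u)
      (by rw [h1, c.2, add_assoc, CharTwo.add_self_eq_zero, add_zero]) (h2 _), by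
      rw [planeIso_apply]; simp⟩
  refine (Nat.card_congr (Equiv.ofBijective f ⟨fun c d hcd => ?_, fun ⟨e, he⟩ => ?_⟩)).symm
  · have := DFunLike.congr_fun (congrArg Subtype.val hcd) (0, 1)
    simp only [f, planeIso_apply, zero_smul, one_smul, zero_add, add_right_inj] at this
    exact Subtype.ext (smul_left_injective F hu0 this)
  · obtain ⟨⟨c, y⟩, hy⟩ := E.surjective (e (0, 1))
    replace hy : c • u + y • v = e (0, 1) := hy
    have hp := polar_isometryEquiv e (1, 0) (0, 1)
    rw [he, ← hy, polar_normPlane, polar_add_right, polar_smul_right, polar_smul_right, hv,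
      polar_self, two_smul, CharTwo.add_self_eq_zero] at hp
    have hy1 : y = 1 := by simpa using hp
    rw [hy1, one_smul, add_comm] at hy
    have hq := e.map_app (0, 1)
    rw [← hy, h1, normPlane_apply] at hq
    refine ⟨⟨c, ?_⟩, Subtype.ext (DFunLike.ext _ _ fun x => ?_)⟩
    · rw [← CharTwo.add_eq_iff_eq_add]; simpa using hq
    · have hx : x = x.1 • (1, 0) + x.2 • (0, 1) := by simp
      conv_rhs => rw [hx, map_add, map_smul, map_smul]
      exact congrArg₂ (fun p q => x.1 • p + x.2 • q) he.symm hy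

/-- Each nonzero v is uniquely a nonzero scalar times a unit vector, the scalar being the square
root of Q(v); hence (q - 1)N = q² - 1. -/
theorem natCard_unit_vectors [Fintype F] [FiniteDimensional F V] {Q : QuadraticForm F V}
    (hV : Module.finrank F V = 2) (hQ : Q.Anisotropic) :
    Nat.card {u // Q u = 1} = Fintype.card F + 1 := by
  have := Module.finite_of_finite F (M := V)
  classical
  let f : Fˣ × {u // Q u = 1} → {v : V // v ≠ 0} := fun p => ⟨p.1.1 • p.2.1, fun h => by
    have h0 := (smul_eq_zero_iff_right p.1.ne_zero).1 h
    have h1 := p.2.2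
    simp [h0] at h1⟩
  have hf : Function.Bijective f := by
    refine ⟨fun ⟨c, u, hu⟩ ⟨d, v, hv⟩ h => ?_, fun ⟨v, hv⟩ => ?_⟩
    · have h : (c : F) • u = (d : F) • v := congrArg Subtype.val h
      have h1 := congrArg Q h
      rw [QuadraticMap.map_smul, QuadraticMap.map_smul, hu, hv, smul_eq_mul, smul_eq_mul, mul_one,
        mul_one, ← pow_two, ← pow_two] at h1
      have hcd : c = d := Units.ext (CharTwo.sq_injective h1)
      subst hcd
      have := smul_right_injective V c.ne_zero h
      subst this; rfl
    · obtain ⟨c, hc⟩ := (frobeniusEquiv F 2).surjective (Q v)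
      rw [frobeniusEquiv_def] at hc
      have hc0 : c ≠ 0 := fun h => hv (hQ v (by rw [← hc, h]; simp))
      refine ⟨(Units.mk0 c hc0, ⟨c⁻¹ • v, ?_⟩), Subtype.ext ?_⟩
      · rw [QuadraticMap.map_smul, ← hc, smul_eq_mul]; field_simp
      · exact smul_inv_smul₀ hc0 v
  have h1 := Nat.card_congr (Equiv.ofBijective f hf)
  have h2 : Nat.card {v : V // v ≠ 0} + 1 = Fintype.card F ^ 2 := by
    have := Fintype.ofFinite V
    rw [← hV, ← Nat.card_eq_fintype_card (α := F), ← Module.natCard_eq_pow_finrank (K := F),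
      Nat.card_eq_fintype_card, Nat.card_eq_fintype_card, Fintype.card_subtype_compl,
      Fintype.card_subtype_eq]
    exact Nat.sub_add_cancel Fintype.card_pos
  rw [Nat.card_prod, Nat.card_units, Nat.card_eq_fintype_card (α := F)] at h1
  have h3 := Fintype.one_lt_card (α := F)
  obtain ⟨k, hk⟩ : ∃ k, Fintype.card F = k + 2 := ⟨Fintype.card F - 2, by omega⟩
  rw [hk] at h1 h2 ⊢
  rw [← h1] at h2
  have h4 : k + 2 - 1 = k + 1 := rfl
  rw [h4] at h2
  refine Nat.eq_of_mul_eq_mul_left (Nat.succ_pos k) ?_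
  rw [Nat.succ_eq_add_one]
  linarith

theorem natCard_isometryEquiv_normPlane [Fintype F] [FiniteDimensional F V]
    {Q : QuadraticForm F V} (hV : Module.finrank F V = 2) (hnd : Q.polarBilin.SeparatingLeft)
    (hQ : Q.Anisotropic) {a : F} (ha : a ∉ (artinSchreier F).range) :
    Nat.card ((normPlane a).IsometryEquiv Q) = (Fintype.card F + 1) * 2 := by
  have := Module.finite_of_finite F (M := V)
  have := finite_isometryEquiv (normPlane a) Q
  rw [← natCard_unit_vectors hV hQ]
  refine natCard_eq_mul_of_fibers (fun e => ⟨e (1, 0), by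
    rw [e.map_app, normPlane_apply]; simp⟩) 2 fun ⟨u, hu⟩ => ?_
  exact (Nat.card_congr (Equiv.subtypeEquivRight fun e => by simp)).trans
    (natCard_planeIso_fiber hV hnd hQ ha hu)

theorem exists_normPlane_isometryEquiv [Fintype F] [FiniteDimensional F V]
    {Q : QuadraticForm F V} (hV : Module.finrank F V = 2) (hnd : Q.polarBilin.SeparatingLeft)
    (hQ : Q.Anisotropic) :
    ∃ a : F, a ∉ (artinSchreier F).range ∧ Nonempty ((normPlane a).IsometryEquiv Q) := by
  have h1 : 0 < Nat.card {u // Q u = 1} := by rw [natCard_unit_vectors hV hQ]; omega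
  obtain ⟨⟨⟨u, hu⟩⟩, -⟩ := Nat.card_pos_iff.1 h1
  obtain ⟨v, hv⟩ := exists_bilin_eq_one hnd (fun h => by simp [h] at hu : u ≠ 0)
  let E := planeIso hV hu rfl hv
  exact ⟨Q v, notMem_range_of_anisotropic (anisotropic_of_isometryEquiv hQ E), ⟨E⟩⟩

end AnisotropicPlane

/-! ### The order formula -/

section Order

/-- The order of the orthogonal group of sign `ε` in dimension `2 m` over a field of order `q`. -/
def orthogonalOrder (q ε : ℤ) : ℕ → ℤ
  -- The group of the zero space is trivial, whereas the closed formula would give 0 for `ε = 1`.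
  | 0 => 1
  | m + 1 => 2 * (q ^ (m + 1) - ε) * q ^ ((m + 1) * m) *
      ∏ i ∈ Finset.range m, (q ^ (2 * (i + 1)) - 1)

/-- The factor in front is the number of hyperbolic pairs. For m = 0 and ε = -1 it vanishes, as the
anisotropic plane has no such pair, so this case is excluded by `h0`. -/
theorem orthogonalOrder_succ {q ε : ℤ} {m : ℕ} (hε : ε * ε = 1) (h0 : m = 0 → ε = 1) :
    orthogonalOrder q ε (m + 1) =
      (q ^ (m + 1) - ε) * (q ^ m + ε) * q ^ (2 * m) * orthogonalOrder q ε m := by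
  cases m with
  | zero => rw [h0 rfl]; simp [orthogonalOrder]; ring
  | succ m =>
    rw [orthogonalOrder, orthogonalOrder, Finset.prod_range_succ]
    have h : q ^ (2 * (m + 1)) - 1 = (q ^ (m + 1) + ε) * (q ^ (m + 1) - ε) := by
      rw [← hε]; ring
    rw [h]; ring

theorem orthogonalOrder_eq {q ε : ℤ} {m : ℕ} (hm : 1 ≤ m) :
    orthogonalOrder q ε m = 2 * (q ^ m - ε) * q ^ (m * (m - 1)) *
      ∏ i ∈ Finset.Icc 1 (m - 1), (q ^ (2 * m - 2 * i) - 1) := by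
  obtain ⟨k, rfl⟩ : ∃ k, m = k + 1 := ⟨m - 1, by omega⟩
  rw [orthogonalOrder, Nat.add_sub_cancel]
  congr 1
  refine Finset.prod_nbij' (fun i => k - i) (fun i => k - i) ?_ ?_ ?_ ?_ ?_
  · intro i hi; simp only [Finset.mem_range, Finset.mem_Icc] at *; omega
  · intro i hi; simp only [Finset.mem_range, Finset.mem_Icc] at *; omega
  · intro i hi; simp only [Finset.mem_range] at *; omega
  · intro i hi; simp only [Finset.mem_Icc] at *; omega
  · intro i hi
    simp only [Finset.mem_range] at hi
    congr 2; omega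

theorem orthogonalOrder_injective {q : ℤ} (hq : 2 ≤ q) {m : ℕ} (hm : 1 ≤ m) {ε ε' : ℤ}
    (h : orthogonalOrder q ε m = orthogonalOrder q ε' m) : ε = ε' := by
  obtain ⟨k, rfl⟩ : ∃ k, m = k + 1 := ⟨m - 1, by omega⟩
  rw [orthogonalOrder, orthogonalOrder] at h
  have h1 : ∏ i ∈ Finset.range k, (q ^ (2 * (i + 1)) - 1) ≠ 0 :=
    Finset.prod_ne_zero_iff.2 fun i _ =>
      (sub_pos.2 (one_lt_pow₀ (show 1 < q by omega) (by omega))).ne'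
  have h2 := mul_right_cancel₀ (pow_ne_zero _ (show q ≠ 0 by omega)) (mul_right_cancel₀ h1 h)
  linarith

end Order

/-! ### Even dimension: isometries and group orders -/

section Even

variable {F V : Type*} [Field F] [Fintype F] [CharP F 2] [AddCommGroup V] [Module F V]

/-- The number of isometries between two nondegenerate forms of the same type. -/
theorem natCard_isometryEquiv {F : Type*} [Field F] [Fintype F] [CharP F 2] (m : ℕ) :
    ∀ {V V' : Type*} [AddCommGroup V] [Module F V] [FiniteDimensional F V]
      [AddCommGroup V'] [Module F V'] [FiniteDimensional F V']
      {Q : QuadraticForm F V} {Q' : QuadraticForm F V'},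
      Q.polarBilin.SeparatingLeft → Q'.polarBilin.SeparatingLeft →
      Module.finrank F V = 2 * m → Module.finrank F V' = 2 * m → typeSign Q = typeSign Q' →
      (Nat.card (Q.IsometryEquiv Q') : ℤ) =
        orthogonalOrder (Fintype.card F) (typeSign Q') m := by
  induction m with
  | zero =>
    intro V V' _ _ _ _ _ _ Q Q' _ _ hd hd' _
    have : Subsingleton V := Module.finrank_zero_iff.1 hd
    have : Subsingleton V' := Module.finrank_zero_iff.1 hd'
    rw [orthogonalOrder, Nat.cast_eq_one, Nat.card_eq_one_iff_unique]
    refine ⟨⟨fun e f => DFunLike.ext _ _ fun x => Subsingleton.elim _ _⟩,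
      ⟨{ LinearEquiv.ofFinrankEq V V' (hd.trans hd'.symm) with map_app' := fun x => ?_ }⟩⟩
    rw [Subsingleton.elim x 0]
    simp
  | succ m ih =>
    intro V V' _ _ _ _ _ _ Q Q' hnd hnd' hd hd' hs
    have := Module.finite_of_finite F (M := V)
    have := Module.finite_of_finite F (M := V')
    have : Nontrivial V := Module.finrank_pos_iff (R := F).1 (by omega)
    have : Nontrivial V' := Module.finrank_pos_iff (R := F).1 (by omega)
    by_cases h : ∃ u v, IsHypPair Q u v
    · obtain ⟨u, v, huv⟩ := h
      have hs₁ := typeSign_perpForm hnd hd huv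
      have hd₁ := finrank_perp huv
      have hc : ∀ u' v', IsHypPair Q' u' v' →
          (Nat.card ((perpForm Q u v).IsometryEquiv (perpForm Q' u' v')) : ℤ) =
            orthogonalOrder (Fintype.card F) (typeSign Q') m := fun u' v' h' => by
        have hs' := typeSign_perpForm hnd' hd' h'
        have hd₂ := finrank_perp h'
        rw [ih (separatingLeft_perpForm hnd huv) (separatingLeft_perpForm hnd' h') (by omega)
          (by omega) (by rw [hs₁, hs', hs]), hs']
      rw [natCard_isometryEquiv_congr Q' (hypSplit huv), natCard_isometryEquiv_hypExt
        (orthogonalOrder (Fintype.card F) (typeSign Q') m).toNat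
        fun u' v' h' => by rw [← hc u' v' h', Int.toNat_natCast]]
      have hpairs := natCard_isHypPair hnd' hd'
      rw [Nat.cast_mul, hpairs, orthogonalOrder_succ (typeSign_mul_self Q')]
      -- Without hyperbolic pairs in `Q'` both sides vanish; with one, the integer is a cardinality
      -- and `toNat` loses nothing.
      · obtain hp | hp := (Nat.card {p : V' × V' // IsHypPair Q' p.1 p.2}).eq_zero_or_pos
        · rw [← hpairs, hp]; simp
        · obtain ⟨⟨⟨⟨u', v'⟩, h'⟩⟩, -⟩ := Nat.card_pos_iff.1 hp
          rw [← hc u' v' h', Int.toNat_natCast]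
      · rintro rfl
        rw [← hs, ← hs₁, typeSign, if_pos]
        refine ⟨⊥, fun w hw => by rw [(Submodule.mem_bot F).1 hw, map_zero], ?_⟩
        rw [finrank_bot]; omega
    · have hanis : Q.Anisotropic := fun u hu => by
        by_contra hu0
        obtain ⟨v, huv⟩ := exists_isHypPair hnd hu0 hu
        exact h ⟨u, v, huv⟩
      have hm : m = 0 := by
        by_contra hm
        obtain ⟨u, hu, hu0⟩ := exists_singular Q (by omega)
        exact hu (hanis u hu0)
      subst hm
      have hplus : ¬ IsPlusType Q := fun hp => by
        obtain ⟨u, v, huv, -⟩ := hp.exists_perpForm hnd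
        exact h ⟨u, v, huv⟩
      have hplus' : ¬ IsPlusType Q' := fun hp => hplus ((typeSign_eq_iff.1 hs).2 hp)
      have hanis' : Q'.Anisotropic := fun u hu => by
        by_contra hu0
        -- A singular line is half of a plane and would give `Q'` plus type.
        refine hplus' ⟨F ∙ u, fun w hw => ?_, by rw [finrank_span_singleton hu0, hd']⟩
        obtain ⟨c, rfl⟩ := Submodule.mem_span_singleton.1 hw
        rw [QuadraticMap.map_smul, hu, smul_zero]
      obtain ⟨a, ha, ⟨e⟩⟩ := exists_normPlane_isometryEquiv hd hnd hanis
      rw [natCard_isometryEquiv_congr Q' e, natCard_isometryEquiv_normPlane hd' hnd' hanis' ha,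
        typeSign, if_neg hplus']
      simp [orthogonalOrder]; ring

variable [FiniteDimensional F V] {Q Q' : QuadraticForm F V} {m : ℕ}

theorem natCard_orthogonalGroup_even (hQ : IsNonsingular Q) (hV : Module.finrank F V = 2 * m) :
    (Nat.card (orthogonalGroup Q) : ℤ) = orthogonalOrder (Fintype.card F) (typeSign Q) m := by
  have h := separatingLeft_of_even hQ hV
  rw [natCard_orthogonalGroup, natCard_isometryEquiv m h h hV hV rfl]

/-- There are as many isometries from `Q` to `Q'` as elements in the orthogonal group of `Q'`, hence
at least one. -/
theorem nonempty_isometryEquiv (hQ : IsNonsingular Q) (hQ' : IsNonsingular Q')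
    (hV : Module.finrank F V = 2 * m) (h : IsPlusType Q ↔ IsPlusType Q') :
    Nonempty (Q.IsometryEquiv Q') := by
  have h1 := natCard_isometryEquiv m (separatingLeft_of_even hQ hV)
    (separatingLeft_of_even hQ' hV) hV hV (typeSign_eq_iff.2 h)
  rw [← natCard_orthogonalGroup_even hQ' hV, Nat.cast_inj] at h1
  have := Module.finite_of_finite F (M := V)
  have : Finite (V ≃ₗ[F] V) := DFunLike.finite _
  have h2 : 0 < Nat.card (orthogonalGroup Q') := Nat.card_pos
  rw [← h1] at h2
  exact (Nat.card_pos_iff.1 h2).1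

end Even

/-! ### Existence of nonsingular forms -/

section Existence

universe u

/-- Adding hyperbolic planes to a nonsingular form preserves nonsingularity and type. -/
theorem exists_form_add_hyperbolic {F V₀ : Type u} [Field F] [Fintype F] [CharP F 2]
    [AddCommGroup V₀] [Module F V₀] [FiniteDimensional F V₀] {Q₀ : QuadraticForm F V₀}
    (hQ₀ : IsNonsingular Q₀) (k : ℕ) :
    ∃ (W : Type u) (_ : AddCommGroup W) (_ : Module F W) (_ : FiniteDimensional F W)
      (Q : QuadraticForm F W), IsNonsingular Q ∧
        Module.finrank F W = Module.finrank F V₀ + 2 * k ∧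
        (Even (Module.finrank F V₀) → (IsPlusType Q ↔ IsPlusType Q₀)) := by
  induction k with
  | zero => exact ⟨V₀, _, _, inferInstance, Q₀, hQ₀, rfl, fun _ => Iff.rfl⟩
  | succ k ih =>
    obtain ⟨W, _, _, _, Q, hQ, hd, ht⟩ := ih
    refine ⟨F × F × W, _, _, inferInstance, hypExt Q, isNonsingular_hypExt hQ, ?_, fun h => ?_⟩
    · simp only [Module.finrank_prod, Module.finrank_self]; omega
    · rw [← ht h, ← typeSign_eq_iff]
      obtain ⟨j, hj⟩ := h
      have hW : Module.finrank F W = 2 * (j + k) := by omega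
      exact typeSign_hypExt (separatingLeft_of_even hQ hW) hW

variable {F : Type u} {V : Type*} [Field F] [Fintype F] [CharP F 2] [AddCommGroup V]
  [Module F V] [FiniteDimensional F V]

theorem exists_form_of_finrank_eq {V₀ : Type u} [AddCommGroup V₀] [Module F V₀]
    [FiniteDimensional F V₀] {Q₀ : QuadraticForm F V₀} (hQ₀ : IsNonsingular Q₀) {k : ℕ}
    (hV : Module.finrank F V = Module.finrank F V₀ + 2 * k) :
    ∃ Q : QuadraticForm F V, IsNonsingular Q ∧
      (Even (Module.finrank F V₀) → (IsPlusType Q ↔ IsPlusType Q₀)) := by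
  obtain ⟨W, _, _, _, Q, hQ, hd, ht⟩ := exists_form_add_hyperbolic hQ₀ k
  let E : V ≃ₗ[F] W := LinearEquiv.ofFinrankEq V W (hV.trans hd.symm)
  let e : (Q.comp E.toLinearMap).IsometryEquiv Q := { E with map_app' := fun _ => rfl }
  refine ⟨Q.comp E.toLinearMap, isNonsingular_of_isometryEquiv e.symm hQ, fun h => ?_⟩
  rw [← ht h]
  exact ⟨fun h => h.of_isometryEquiv e, fun h => h.of_isometryEquiv e.symm⟩

theorem exists_isNonsingular_odd {m : ℕ} (hV : Module.finrank F V = 2 * m + 1) :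
    ∃ Q : QuadraticForm F V, IsNonsingular Q := by
  -- The starting form is x² on a line; its polar form is zero, but it has no nonzero singular
  -- vector.
  have h : IsNonsingular (QuadraticMap.sq (R := F)) :=
    isNonsingular_iff.2 fun v hv _ => by simpa using hv
  obtain ⟨Q, hQ, -⟩ := exists_form_of_finrank_eq (V := V) h (k := m)
    (by rw [Module.finrank_self]; omega)
  exact ⟨Q, hQ⟩

theorem exists_isPlusType {m : ℕ} (hV : Module.finrank F V = 2 * m) :
    ∃ Q : QuadraticForm F V, IsNonsingular Q ∧ IsPlusType Q := by
  have h : IsNonsingular (0 : QuadraticForm F (Fin 0 → F)) :=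
    isNonsingular_iff.2 fun v _ _ => Subsingleton.elim _ _
  obtain ⟨Q, hQ, hp⟩ := exists_form_of_finrank_eq (V := V) h (k := m) (by simp [hV])
  exact ⟨Q, hQ, (hp (by simp)).2 ⟨⊥, fun _ _ => rfl, by simp⟩⟩

/-- Hyperbolic planes are added to an anisotropic plane, which has no singular line and so is not of
plus type. -/
theorem exists_not_isPlusType {m : ℕ} (hm : 1 ≤ m) (hV : Module.finrank F V = 2 * m) :
    ∃ Q : QuadraticForm F V, IsNonsingular Q ∧ ¬ IsPlusType Q := by
  obtain ⟨a, ha⟩ := exists_notMem_range_artinSchreier (F := F)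
  obtain ⟨Q, hQ, hp⟩ := exists_form_of_finrank_eq (V := V) (isNonsingular_normPlane a) (k := m - 1)
    (by simp only [Module.finrank_prod, Module.finrank_self]; omega)
  refine ⟨Q, hQ, fun h => ?_⟩
  obtain ⟨T, hT, hd⟩ := (hp (by simp)).1 h
  have hT0 : T = ⊥ := eq_bot_iff.2 fun t ht => normPlane_anisotropic ha t (hT t ht)
  rw [hT0] at hd
  simp at hd

end Existence

end OrthogonalChar2

theorem mainTheorem3 {F : Type*} [Field F] [Fintype F] [CharP F 2]
    {V : Type*} [AddCommGroup V] [Module F V] [FiniteDimensional F V]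
    (n : ℕ) (hn : 1 ≤ n) (hV : Module.finrank F V = n) :
    -- odd dimension: one orthogonal group up to isomorphism, namely `Sp(n - 1)`
    (∀ m : ℕ, n = 2 * m + 1 →
      (∃ Q : QuadraticForm F V, OrthogonalChar2.IsNonsingular Q) ∧
      (∀ Q : QuadraticForm F V, OrthogonalChar2.IsNonsingular Q →
        Nonempty (OrthogonalChar2.orthogonalGroup Q ≃* Matrix.symplecticGroup (Fin m) F)) ∧
      (∀ Q Q' : QuadraticForm F V,
        OrthogonalChar2.IsNonsingular Q → OrthogonalChar2.IsNonsingular Q' →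
        Nonempty (OrthogonalChar2.orthogonalGroup Q ≃* OrthogonalChar2.orthogonalGroup Q'))) ∧
    -- even dimension: two orthogonal groups up to isomorphism, with different orders
    (∀ m : ℕ, n = 2 * m →
      (∃ Q : QuadraticForm F V,
        OrthogonalChar2.IsNonsingular Q ∧ OrthogonalChar2.IsPlusType Q) ∧
      (∃ Q : QuadraticForm F V,
        OrthogonalChar2.IsNonsingular Q ∧ ¬ OrthogonalChar2.IsPlusType Q) ∧
      (∀ Q Q' : QuadraticForm F V,
        OrthogonalChar2.IsNonsingular Q → OrthogonalChar2.IsNonsingular Q' →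
        (Nonempty (OrthogonalChar2.orthogonalGroup Q ≃* OrthogonalChar2.orthogonalGroup Q') ↔
          (OrthogonalChar2.IsPlusType Q ↔ OrthogonalChar2.IsPlusType Q')) ∧
        (Nonempty (OrthogonalChar2.orthogonalGroup Q ≃* OrthogonalChar2.orthogonalGroup Q') ↔
          Nat.card (OrthogonalChar2.orthogonalGroup Q) =
            Nat.card (OrthogonalChar2.orthogonalGroup Q'))) ∧
      (∀ Q : QuadraticForm F V,
        OrthogonalChar2.IsNonsingular Q → OrthogonalChar2.IsPlusType Q →
        (Nat.card (OrthogonalChar2.orthogonalGroup Q) : ℤ) =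
          2 * ((Fintype.card F : ℤ) ^ m - 1) * (Fintype.card F : ℤ) ^ (m * (m - 1)) *
            ∏ i ∈ Finset.Icc 1 (m - 1), ((Fintype.card F : ℤ) ^ (2 * m - 2 * i) - 1)) ∧
      (∀ Q : QuadraticForm F V,
        OrthogonalChar2.IsNonsingular Q → ¬ OrthogonalChar2.IsPlusType Q →
        (Nat.card (OrthogonalChar2.orthogonalGroup Q) : ℤ) =
          2 * ((Fintype.card F : ℤ) ^ m + 1) * (Fintype.card F : ℤ) ^ (m * (m - 1)) *
            ∏ i ∈ Finset.Icc 1 (m - 1), ((Fintype.card F : ℤ) ^ (2 * m - 2 * i) - 1))) := by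
  subst hV
  refine ⟨fun m hm => ⟨OrthogonalChar2.exists_isNonsingular_odd hm,
    fun Q hQ => OrthogonalChar2.nonempty_orthogonalGroup_odd_mulEquiv hm hQ,
    fun Q Q' hQ hQ' => ?_⟩, fun m hm => ?_⟩
  · obtain ⟨e⟩ := OrthogonalChar2.nonempty_orthogonalGroup_odd_mulEquiv hm hQ
    obtain ⟨e'⟩ := OrthogonalChar2.nonempty_orthogonalGroup_odd_mulEquiv hm hQ'
    exact ⟨e.trans e'.symm⟩
  have hm1 : 1 ≤ m := by omega
  refine ⟨OrthogonalChar2.exists_isPlusType hm, OrthogonalChar2.exists_not_isPlusType hm1 hm,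
    fun Q Q' hQ hQ' => ?_, fun Q hQ hp => ?_, fun Q hQ hp => ?_⟩
  · have hcard : Nonempty (OrthogonalChar2.orthogonalGroup Q ≃* OrthogonalChar2.orthogonalGroup Q') →
        Nat.card (OrthogonalChar2.orthogonalGroup Q) =
          Nat.card (OrthogonalChar2.orthogonalGroup Q') := fun ⟨e⟩ => Nat.card_congr e.toEquiv
    have htype : Nat.card (OrthogonalChar2.orthogonalGroup Q) =
          Nat.card (OrthogonalChar2.orthogonalGroup Q') →
        (OrthogonalChar2.IsPlusType Q ↔ OrthogonalChar2.IsPlusType Q') := fun h => by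
      rw [← Nat.cast_inj (R := ℤ), OrthogonalChar2.natCard_orthogonalGroup_even hQ hm,
        OrthogonalChar2.natCard_orthogonalGroup_even hQ' hm] at h
      exact OrthogonalChar2.typeSign_eq_iff.1
        (OrthogonalChar2.orthogonalOrder_injective OrthogonalChar2.two_le_card hm1 h)
    have hiso : (OrthogonalChar2.IsPlusType Q ↔ OrthogonalChar2.IsPlusType Q') →
        Nonempty (OrthogonalChar2.orthogonalGroup Q ≃* OrthogonalChar2.orthogonalGroup Q') :=
      fun h => (OrthogonalChar2.nonempty_isometryEquiv hQ hQ' hm h).map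
        OrthogonalChar2.orthogonalGroupCongr
    -- The implications form a cycle: isomorphic, same order, same type, isometric, isomorphic.
    exact ⟨⟨htype ∘ hcard, hiso⟩, ⟨hcard, hiso ∘ htype⟩⟩
  · rw [OrthogonalChar2.natCard_orthogonalGroup_even hQ hm, OrthogonalChar2.orthogonalOrder_eq hm1,
      OrthogonalChar2.typeSign, if_pos hp]
  · rw [OrthogonalChar2.natCard_orthogonalGroup_even hQ hm, OrthogonalChar2.orthogonalOrder_eq hm1,
      OrthogonalChar2.typeSign, if_neg hp, sub_neg_eq_add]
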